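/- Let $G$ be a finite group and let $\mathbb{K}$ be $\mathbb{R}$ or $\mathbb{C}$. **Universes.** A $G$-universe over $\mathbb{K}$ is an orthogonal (unitary if $\mathbb{K}=\mathbb{C}$) $G$-representation $\mathcal{U}$ over $\mathbb{K}$ of countably infinite dimension that contains a non-zero subrepresentation with trivial action, and such that for every finite-dimensional subrepresentation $V\subset\mathcal{U}$ and every $n\in\mathbb{N}$ the representation $V^{\oplus n}$ embeds $G$-equivariantly into $\mathcal{U}$. For $H\le G$ and $N\trianglelefteq G$ the operations $\mathrm{res}^G_H$, $\mathrm{ind}^G_H$, $(-)^N$, $\inf^G_{G/N}$ on universes are restriction, induction, $N$-fixed points and inflation of representations. **Transfer systems.** A $G$-transfer system is a partial order $\to$ on the set of subgroups of $G$ that refines inclusion and is closed under restriction ($L\to H$ and $K\le H$ imply $K\cap L\to K$) and conjugation; they are ordered by refinement. For a $G$-transfer system $\mathcal{O}$, an $H$-transfer system $\mathcal{P}$ and a $G/N$-transfer system $\mathcal{Q}$: $L\to K$ in $\mathrm{res}^G_H\mathcal{O}$ iff $L\le K\le H$ and $L\to_{\mathcal{O}}K$; $\mathrm{coind}^G_H$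 is the right adjoint of $\mathrm{res}^G_H$ (for $G$ abelian, $L\to K$ in $\mathrm{coind}^G_H\mathcal{P}$ iff $L\le K$ and $L\cap H\to_{\mathcal{P}}K\cap H$); $K/N\to H/N$ in $\mathcal{O}^N$ iff $N\le K\le H$ and $K\to_{\mathcal{O}}H$; and $M\to L$ in $\inf^G_{G/N}\mathcal{Q}$ iff there are $N\le K\le H\le G$ with $L\le H$, $M=K\cap L$ and $K/N\to_{\mathcal{Q}}H/N$. **The maps $\mathcal{D}$ and $\mathcal{L}$.** A $G$-operad $\mathcal{X}$ determines the relation: $K\to_{\mathcal{X}}H$ iff $K\le H$ and, for $n=|H/K|$, the space $\mathcal{X}(n)$ has a point fixed by the graph $\{(h,\sigma(h)) : h\in H\}\le G\times\Sigma_n$ of the permutation representation $\sigma$ of $H$ on $H/K$. For a universe $\mathcal{U}$ over $\mathbb{K}$, $\mathcal{D}(\mathcal{U})$ is the transfer system of the infinite little discs operad of (the real universe underlying) $\mathcal{U}$, whose $n$-th space is the colimit, over the finite-dimensional subrepresentations $V$, of the spaces of $n$ disjoint little discs in the unit disc of $V$. If $\mathbb{K}=\mathbb{R}$, $\mathcal{L}(\mathcal{U})$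 is the transfer system of the linear isometries operad, whose $n$-th space is the space of (not necessarily equivariant) linear isometries $\mathcal{U}^{\oplus n}\to\mathcal{U}$. If $\mathbb{K}=\mathbb{C}$, $\mathcal{L}(\mathcal{U})$ is the transfer system with $K\to H$ iff $K\le H$ and $\mathrm{ind}^H_K\mathrm{res}^G_K\mathcal{U}$ embeds $H$-equivariantly into $\mathrm{res}^G_H\mathcal{U}$. Then: 1. $\mathcal{D}$ and $\mathcal{L}$ commute with restriction: for every $G$-universe $\mathcal{U}$ over $\mathbb{K}$ and every subgroup $H\le G$, $\mathcal{D}(\mathrm{res}^G_H\mathcal{U})=\mathrm{res}^G_H\mathcal{D}(\mathcal{U})$ and $\mathcal{L}(\mathrm{res}^G_H\mathcal{U})=\mathrm{res}^G_H\mathcal{L}(\mathcal{U})$. (Over both fields, this holds for $\mathcal{L}$ defined by linear isometries, with $\mathbb{K}$-linear isometries, as well as for $\mathcal{L}$ defined by embeddings of induced representations.) 2. For every normal subgroup $N\trianglelefteq G$ and every $G$-universe $\mathcal{U}$ over $\mathbb{K}$, $\mathcal{D}(\mathcal{U})^N=\mathcal{D}(\mathcal{U}^N)$. 3. For every normal subgroup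 $N\trianglelefteq G$ and every $G/N$-universe $\mathcal{W}$ over $\mathbb{K}$, $\mathcal{D}(\inf^G_{G/N}\mathcal{W})=\inf^G_{G/N}\mathcal{D}(\mathcal{W})$. 4. If $G$ is abelian, then for every subgroup $H\le G$ and every $H$-universe $\mathcal{U}$ over $\mathbb{K}$, $\mathcal{D}(\mathrm{ind}^G_H\mathcal{U})=\mathrm{coind}^G_H\mathcal{D}(\mathcal{U})$. -/

import Mathlib

open Cardinal
open scoped InnerProductSpace

universe u v w

/-! ## Transfer systems and change of group -/

/-- A transfer system on `G`: a partial order on the subgroups of `G` that refines inclusion and is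
closed under restriction and conjugation. (Antisymmetry follows from `le_of_rel`.) -/
@[ext]
structure TransferSystem (G : Type v) [Group G] where
  rel : Subgroup G → Subgroup G → Prop
  refl : ∀ H, rel H H
  trans : ∀ {L K H}, rel L K → rel K H → rel L H
  le_of_rel : ∀ {K H}, rel K H → K ≤ H
  restrict : ∀ {L H K}, rel L H → K ≤ H → rel (K ⊓ L) K
  conj : ∀ {K H} (g : G), rel K H →
    rel (K.map (MulAut.conj g).toMonoidHom) (H.map (MulAut.conj g).toMonoidHom)

namespace TransferSystem

variable {G : Type v} [Group G]

/-- `O ≤ P` if every transfer of `O` is a transfer of `P`. -/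
instance : PartialOrder (TransferSystem G) where
  le O P := ∀ K H, O.rel K H → P.rel K H
  le_refl _ _ _ h := h
  le_trans _ _ _ h₁ h₂ K H h := h₂ K H (h₁ K H h)
  le_antisymm O P h₁ h₂ := by
    ext K H
    exact ⟨h₁ K H, h₂ K H⟩

lemma mem_map_conj (K : Subgroup G) (g x : G) :
    x ∈ K.map (MulAut.conj g).toMonoidHom ↔ g⁻¹ * x * g ∈ K := by
  constructor
  · rintro ⟨y, hy, rfl⟩
    simpa [mul_assoc] using hy
  · intro h
    exact ⟨_, h, by simp [mul_assoc]⟩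

lemma map_conj_subtype (H : Subgroup G) (K : Subgroup H) (h : H) :
    (K.map (MulAut.conj h).toMonoidHom).map H.subtype =
      (K.map H.subtype).map (MulAut.conj (h : G)).toMonoidHom := by
  rw [Subgroup.map_map, Subgroup.map_map]
  congr 1

/-- Restriction to a subgroup `H`: `L → K` if and only if `L ≤ K ≤ H` and `L → K` in `O`. -/
def res (O : TransferSystem G) (H : Subgroup G) : TransferSystem H where
  rel L K := O.rel (L.map H.subtype) (K.map H.subtype)
  refl _ := O.refl _
  trans := O.trans
  le_of_rel h := (Subgroup.map_le_map_iff_of_injective H.subtype_injective).1 (O.le_of_rel h)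
  restrict h hK := by
    rw [Subgroup.map_inf _ _ _ H.subtype_injective]
    exact O.restrict h (Subgroup.map_mono hK)
  conj g h := by
    rw [map_conj_subtype, map_conj_subtype]
    exact O.conj _ h

/-- Coinduction from a subgroup `H` to `G`: there is a transfer `L → K` if and only if `L ≤ K` and
`gLg⁻¹ ∩ H → gKg⁻¹ ∩ H` in `P` for every `g`. This is the right adjoint of restriction, see
`gc_res_coind`; for abelian `G` the conjugations disappear, see `coind_rel_of_comm`. -/
def coind {H : Subgroup G} (P : TransferSystem H) : TransferSystem G where
  rel L K := L ≤ K ∧ ∀ g : G, P.rel ((L.map (MulAut.conj g).toMonoidHom).subgroupOf H)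
    ((K.map (MulAut.conj g).toMonoidHom).subgroupOf H)
  refl _ := ⟨le_rfl, fun _ => P.refl _⟩
  trans h₁ h₂ := ⟨h₁.1.trans h₂.1, fun g => P.trans (h₁.2 g) (h₂.2 g)⟩
  le_of_rel h := h.1
  restrict {L M K} h hK := by
    refine ⟨inf_le_left, fun g => ?_⟩
    rw [Subgroup.map_inf _ _ _ (MulAut.conj g).injective]
    have := P.restrict (h.2 g) (Subgroup.comap_mono (f := H.subtype)
      (Subgroup.map_mono (f := (MulAut.conj g).toMonoidHom) hK))
    exact this
  conj {K M} g h := by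
    refine ⟨Subgroup.map_mono h.1, fun g' => ?_⟩
    have e : ∀ S : Subgroup G, (S.map (MulAut.conj g).toMonoidHom).map
        (MulAut.conj g').toMonoidHom = S.map (MulAut.conj (g' * g)).toMonoidHom := by
      intro S
      rw [Subgroup.map_map, map_mul]
      rfl
    rw [e, e]
    exact h.2 _

/-- Coinduction is right adjoint to restriction. -/
theorem gc_res_coind (H : Subgroup G) :
    GaloisConnection (fun O : TransferSystem G => O.res H) coind := by
  intro O P
  constructor
  · intro h L K hLK
    refine ⟨O.le_of_rel hLK, fun g => h _ _ ?_⟩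
    have h1 := O.conj g hLK
    have h2 := O.restrict h1 (inf_le_left (b := H))
    change O.rel _ _
    rw [Subgroup.subgroupOf_map_subtype, Subgroup.subgroupOf_map_subtype]
    convert h2 using 1
    have := O.le_of_rel h1
    ext x
    simp only [Subgroup.mem_inf]
    exact ⟨fun hx => ⟨⟨this hx.1, hx.2⟩, hx.1⟩, fun hx => ⟨hx.2, hx.1.2⟩⟩
  · intro h L K hLK
    have := (h _ _ hLK).2 1
    have e : ∀ S : Subgroup H, (((S.map H.subtype).map
        (MulAut.conj (1 : G)).toMonoidHom).subgroupOf H) = S := by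
      intro S
      ext x
      simp [Subgroup.mem_subgroupOf]
    rwa [e, e] at this

/-- For abelian `G`, `L → K` in the coinduced transfer system if and only if `L ≤ K` and
`L ∩ H → K ∩ H` in `P`. -/
theorem coind_rel_of_comm (hG : ∀ a b : G, a * b = b * a) {H : Subgroup G} (P : TransferSystem H)
    (L K : Subgroup G) : P.coind.rel L K ↔ L ≤ K ∧ P.rel (L.subgroupOf H) (K.subgroupOf H) := by
  have e : ∀ (g : G) (S : Subgroup G), S.map (MulAut.conj g).toMonoidHom = S := by
    intro g S
    have : (MulAut.conj g).toMonoidHom = MonoidHom.id G := by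
      ext x
      simp [hG g x]
    rw [this, Subgroup.map_id]
  simp only [coind, e, forall_const]

lemma comap_conj_mk (N : Subgroup G) [N.Normal] (K : Subgroup (G ⧸ N)) (g : G) :
    (K.map (MulAut.conj (QuotientGroup.mk' N g)).toMonoidHom).comap (QuotientGroup.mk' N) =
      (K.comap (QuotientGroup.mk' N)).map (MulAut.conj g).toMonoidHom := by
  ext x
  simp only [Subgroup.mem_comap, mem_map_conj, map_mul, map_inv]

/-- The fixed points `O^N`: for `N ≤ K ≤ H`, `K/N → H/N` if and only if `K → H` in `O`. -/
def fixedPoints (O : TransferSystem G) (N : Subgroup G) [N.Normal] : TransferSystem (G ⧸ N) where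
  rel K H := O.rel (K.comap (QuotientGroup.mk' N)) (H.comap (QuotientGroup.mk' N))
  refl _ := O.refl _
  trans := O.trans
  le_of_rel h := (Subgroup.comap_le_comap_of_surjective (QuotientGroup.mk'_surjective N)).1
    (O.le_of_rel h)
  restrict h hK := by
    rw [Subgroup.comap_inf]
    exact O.restrict h (Subgroup.comap_mono hK)
  conj g h := by
    obtain ⟨g, rfl⟩ := QuotientGroup.mk'_surjective N g
    rw [comap_conj_mk, comap_conj_mk]
    exact O.conj _ h

/-- Inflation from `G/N` to `G`: `M → L` if and only if there are `N ≤ K ≤ H` with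
`K/N → H/N` in `P`, `L ≤ H` and `M = K ∩ L`. (In the code `K`, `H` are subgroups of `G/N`.) -/
def inflate (N : Subgroup G) [N.Normal] (P : TransferSystem (G ⧸ N)) : TransferSystem G where
  rel M L := ∃ K H : Subgroup (G ⧸ N), P.rel K H ∧ L ≤ H.comap (QuotientGroup.mk' N) ∧
    M = K.comap (QuotientGroup.mk' N) ⊓ L
  refl L := ⟨⊤, ⊤, P.refl _, by simp, by simp⟩
  trans := by
    rintro M L J ⟨K, H, hKH, hL, rfl⟩ ⟨K', H', hKH', hJ, rfl⟩
    set π := QuotientGroup.mk' N with hπ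
    have hJ' : J.map π ≤ H' := Subgroup.map_le_iff_le_comap.2 hJ
    have h1 : P.rel (J.map π ⊓ K') (J.map π) := P.restrict hKH' hJ'
    have h2 : J.map π ⊓ K' ≤ H := by
      rintro x ⟨⟨j, hj, rfl⟩, hx⟩
      exact hL ⟨hx, hj⟩
    have h3 := P.restrict hKH h2
    refine ⟨_, _, P.trans h3 h1, Subgroup.le_comap_map _ _, ?_⟩
    ext x
    simp only [Subgroup.mem_inf, Subgroup.mem_comap]
    constructor
    · rintro ⟨a, b, c⟩
      exact ⟨⟨⟨⟨x, c, rfl⟩, b⟩, a⟩, c⟩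
    · rintro ⟨⟨⟨_, b⟩, a⟩, c⟩
      exact ⟨a, b, c⟩
  le_of_rel := by
    rintro M L ⟨K, H, _, _, rfl⟩
    exact inf_le_right
  restrict := by
    rintro M L J ⟨K, H, hKH, hL, rfl⟩ hJ
    refine ⟨K, H, hKH, hJ.trans hL, ?_⟩
    ext x
    simp only [Subgroup.mem_inf]
    exact ⟨fun h => ⟨h.2.1, h.1⟩, fun h => ⟨h.2, h.1, hJ h.2⟩⟩
  conj := by
    rintro M L g ⟨K, H, hKH, hL, rfl⟩
    refine ⟨_, _, P.conj (QuotientGroup.mk' N g) hKH, ?_, ?_⟩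
    · rw [comap_conj_mk]
      exact Subgroup.map_mono hL
    · rw [comap_conj_mk, Subgroup.map_inf _ _ _ (MulAut.conj g).injective]

end TransferSystem

/-- The relation on subgroups of `G` determined by the arities `X n` of a `G`-operad, each with its
action of `G × Σₙ`: `K → H` if and only if `K ≤ H` and the `H`-set `H/K` is admissible, i.e. for
`n = |H/K|` the space `X n` has a point fixed by the graph
`{(h, σ(h)) | h ∈ H} ≤ G × Σₙ` of the permutation representation `σ : H → Σₙ` of `H` on `H/K`. -/
def OperadTransfer {G : Type v} [Group G] (X : ℕ → Type w)
    [∀ n, MulAction (G × Equiv.Perm (Fin n)) (X n)] (K H : Subgroup G) : Prop :=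
  K ≤ H ∧ ∃ (n : ℕ) (e : (H ⧸ K.subgroupOf H) ≃ Fin n) (x : X n),
    ∀ h : H, ((h : G), e.permCongr (MulAction.toPerm h)) • x = x

/-! ## Universes -/

/-- A `G`-universe over `𝕂` (`ℝ` or `ℂ`): an orthogonal (unitary) `G`-representation of countably
infinite dimension that contains a nonzero subrepresentation with trivial action, and into which
every finite multiple of each of its finite-dimensional subrepresentations embeds. -/
structure GUniverse (𝕂 : Type) [RCLike 𝕂] (G : Type v) [Group G] where
  carrier : Type u
  [normedAddCommGroup : NormedAddCommGroup carrier]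
  [innerProductSpace : InnerProductSpace 𝕂 carrier]
  rep : Representation 𝕂 G carrier
  norm_rep : ∀ g x, ‖rep g x‖ = ‖x‖
  rank_eq : Module.rank 𝕂 carrier = ℵ₀
  exists_fixed : ∃ x : carrier, x ≠ 0 ∧ ∀ g, rep g x = x
  exists_embedding : ∀ V : Subrepresentation rep, FiniteDimensional 𝕂 V.toSubmodule →
    ∀ n : ℕ, ∃ f : (Fin n → V.toSubmodule) →ₗ[𝕂] carrier, Function.Injective f ∧
      ∀ g x, f (fun i => V.toRepresentation g (x i)) = rep g (f x)

attribute [instance] GUniverse.normedAddCommGroup GUniverse.innerProductSpace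

namespace GUniverse

variable {𝕂 : Type} [RCLike 𝕂] {G : Type v} [Group G]

@[simp] lemma rep_inv_rep (U : GUniverse.{u} 𝕂 G) (g : G) (x : U.carrier) :
    U.rep g⁻¹ (U.rep g x) = x := by
  rw [← Module.End.mul_apply, ← map_mul, inv_mul_cancel, map_one, Module.End.one_apply]

@[simp] lemma rep_rep_inv (U : GUniverse.{u} 𝕂 G) (g : G) (x : U.carrier) :
    U.rep g (U.rep g⁻¹ x) = x := by
  rw [← Module.End.mul_apply, ← map_mul, mul_inv_cancel, map_one, Module.End.one_apply]

lemma rep_mul (U : GUniverse.{u} 𝕂 G) (g h : G) (x : U.carrier) :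
    U.rep (g * h) x = U.rep g (U.rep h x) := by
  rw [map_mul, Module.End.mul_apply]

/-- The action of `g` as a linear isometric automorphism. -/
def isom (U : GUniverse.{u} 𝕂 G) (g : G) : U.carrier ≃ₗᵢ[𝕂] U.carrier where
  toFun := U.rep g
  invFun := U.rep g⁻¹
  map_add' := map_add _
  map_smul' := map_smul _
  left_inv x := by simp
  right_inv x := by simp
  norm_map' := U.norm_rep g

@[simp] lemma isom_apply (U : GUniverse.{u} 𝕂 G) (g : G) (x : U.carrier) :
    U.isom g x = U.rep g x := rfl

lemma inner_rep (U : GUniverse.{u} 𝕂 G) (g : G) (x y : U.carrier) :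
    ⟪U.rep g x, U.rep g y⟫_𝕂 = ⟪x, y⟫_𝕂 :=
  (U.isom g).inner_map_map x y

/-- The finite-dimensional subrepresentation generated by a finite-dimensional subspace. -/
def orbitSpan (U : GUniverse.{u} 𝕂 G) (S : Submodule 𝕂 U.carrier) : Subrepresentation U.rep where
  toSubmodule := ⨆ g : G, S.map (U.rep g)
  apply_mem_toSubmodule g v hv := by
    have : (⨆ g : G, S.map (U.rep g)) ≤ (⨆ g : G, S.map (U.rep g)).comap (U.rep g) := by
      refine iSup_le fun h => ?_
      rintro _ ⟨s, hs, rfl⟩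
      rw [Submodule.mem_comap, ← rep_mul]
      exact Submodule.mem_iSup_of_mem (g * h) ⟨s, hs, rfl⟩
    exact this hv

instance [Finite G] (U : GUniverse.{u} 𝕂 G) (S : Submodule 𝕂 U.carrier) [FiniteDimensional 𝕂 S] :
    FiniteDimensional 𝕂 (U.orbitSpan S).toSubmodule :=
  inferInstanceAs (FiniteDimensional 𝕂 (⨆ g : G, S.map (U.rep g) : Submodule 𝕂 U.carrier))

lemma le_orbitSpan (U : GUniverse.{u} 𝕂 G) (S : Submodule 𝕂 U.carrier) :
    S ≤ (U.orbitSpan S).toSubmodule := fun s hs =>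
  Submodule.mem_iSup_of_mem (1 : G) ⟨s, hs, by simp⟩

/-- Restriction of a universe to a subgroup. -/
def res [Finite G] (U : GUniverse.{u} 𝕂 G) (H : Subgroup G) : GUniverse.{u} 𝕂 H where
  carrier := U.carrier
  rep := U.rep.comp H.subtype
  norm_rep g := U.norm_rep g
  rank_eq := U.rank_eq
  exists_fixed := by
    obtain ⟨x, hx, h⟩ := U.exists_fixed
    exact ⟨x, hx, fun g => h g⟩
  exists_embedding V hV n := by
    obtain ⟨f, hf, hfe⟩ := U.exists_embedding (U.orbitSpan V.toSubmodule) inferInstance n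
    let i := Submodule.inclusion (U.le_orbitSpan V.toSubmodule)
    refine ⟨f ∘ₗ i.compLeft (Fin n), hf.comp fun x y hxy => ?_, fun g x => ?_⟩
    · funext j
      exact Submodule.inclusion_injective (U.le_orbitSpan V.toSubmodule) (congrFun hxy j)
    · exact hfe g (fun j => i (x j))

/-- Inflation of a `G/N`-universe to a `G`-universe. -/
def inflate (N : Subgroup G) [N.Normal] (W : GUniverse.{u} 𝕂 (G ⧸ N)) : GUniverse.{u} 𝕂 G where
  carrier := W.carrier
  rep := W.rep.comp (QuotientGroup.mk' N)
  norm_rep g := W.norm_rep _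
  rank_eq := W.rank_eq
  exists_fixed := by
    obtain ⟨x, hx, h⟩ := W.exists_fixed
    exact ⟨x, hx, fun g => h _⟩
  exists_embedding V hV n := by
    obtain ⟨f, hf, hfe⟩ := W.exists_embedding ⟨V.toSubmodule, fun g v hv => by
      obtain ⟨g, rfl⟩ := QuotientGroup.mk'_surjective N g
      exact V.apply_mem_toSubmodule g hv⟩ hV n
    exact ⟨f, hf, fun g x => hfe _ x⟩

/-- The fixed vectors of a universe have infinite dimension. -/
lemma aleph0_le_rank_fixed (U : GUniverse.{u} 𝕂 G) (S : Submodule 𝕂 U.carrier)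
    (hS : ∀ x, (∀ g, U.rep g x = x) → x ∈ S) : ℵ₀ ≤ Module.rank 𝕂 S := by
  obtain ⟨x, hx, h⟩ := U.exists_fixed
  have hspan : ∀ y ∈ Submodule.span 𝕂 {x}, ∀ g, U.rep g y = y := by
    intro y hy g
    obtain ⟨c, rfl⟩ := Submodule.mem_span_singleton.1 hy
    rw [map_smul, h]
  let V : Subrepresentation U.rep := ⟨Submodule.span 𝕂 {x}, fun g v hv => by
    rwa [hspan v hv]⟩
  have hV : FiniteDimensional 𝕂 V.toSubmodule :=
    inferInstanceAs (FiniteDimensional 𝕂 (Submodule.span 𝕂 {x}))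
  refine Cardinal.aleph0_le.2 fun n => ?_
  obtain ⟨f, hf, hfe⟩ := U.exists_embedding V hV n
  have hfix : ∀ y, f y ∈ S := fun y => hS _ fun g => by
    rw [← hfe]
    congr 1
    funext i
    exact Subtype.ext (hspan _ (y i).2 g)
  have h1 := LinearMap.rank_le_of_injective (LinearMap.codRestrict S f hfix)
    (fun a b hab => hf (congrArg Subtype.val hab))
  have h2 : Module.finrank 𝕂 V.toSubmodule = 1 := finrank_span_singleton hx
  have h3 : Module.finrank 𝕂 (Fin n → V.toSubmodule) = n := by
    rw [Module.finrank_pi_fintype]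
    simp [h2]
  rw [← Module.finrank_eq_rank, h3] at h1
  exact h1

/-- The `N`-fixed points of a `G`-universe, as a `G/N`-universe. -/
noncomputable def fixedPoints (U : GUniverse.{u} 𝕂 G) (N : Subgroup G) [N.Normal] :
    GUniverse.{u} 𝕂 (G ⧸ N) where
  carrier := Representation.invariants (U.rep.comp N.subtype)
  rep := Representation.quotientToInvariants U.rep N
  norm_rep g x := by
    obtain ⟨g, rfl⟩ := QuotientGroup.mk'_surjective N g
    exact U.norm_rep g x
  rank_eq := le_antisymm ((Submodule.rank_le _).trans U.rank_eq.le)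
    (U.aleph0_le_rank_fixed _ fun x hx g => hx g)
  exists_fixed := by
    obtain ⟨x, hx, h⟩ := U.exists_fixed
    refine ⟨⟨x, fun g => h g⟩, fun h0 => hx (congrArg Subtype.val h0), fun g => ?_⟩
    obtain ⟨g, rfl⟩ := QuotientGroup.mk'_surjective N g
    exact Subtype.ext (h g)
  exists_embedding V hV n := by
    let I := Representation.invariants (U.rep.comp N.subtype)
    let V' : Subrepresentation U.rep := ⟨V.toSubmodule.map I.subtype, by
      rintro g _ ⟨y, hy, rfl⟩
      exact ⟨_, V.apply_mem_toSubmodule (QuotientGroup.mk' N g) hy, rfl⟩⟩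
    have hV' : FiniteDimensional 𝕂 V'.toSubmodule :=
      inferInstanceAs (FiniteDimensional 𝕂 (V.toSubmodule.map I.subtype))
    obtain ⟨f, hf, hfe⟩ := U.exists_embedding V' hV' n
    let i : V.toSubmodule →ₗ[𝕂] V'.toSubmodule :=
      LinearMap.restrict I.subtype fun x hx => ⟨x, hx, rfl⟩
    have hi : Function.Injective i := fun a b hab =>
      Subtype.ext (Subtype.ext (congrArg (fun z : V'.toSubmodule => z.1) hab :))
    have key : ∀ (g : G) (x : Fin n → V.toSubmodule),
        f (fun j => i (V.toRepresentation (QuotientGroup.mk' N g) (x j))) =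
          U.rep g (f fun j => i (x j)) := fun g x => hfe g fun j => i (x j)
    have hmem : ∀ x, f (i.compLeft (Fin n) x) ∈ I := by
      rintro x ⟨g, hg⟩
      refine (key g x).symm.trans ?_
      have h1 : QuotientGroup.mk' N g = 1 := (QuotientGroup.eq_one_iff g).2 hg
      rw [h1, map_one]
      rfl
    refine ⟨LinearMap.codRestrict I (f ∘ₗ i.compLeft (Fin n)) hmem, fun a b hab => ?_,
      fun g x => ?_⟩
    · funext j
      exact hi (congrFun (hf (congrArg Subtype.val hab)) j)
    · obtain ⟨g, rfl⟩ := QuotientGroup.mk'_surjective N g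
      exact Subtype.ext (key g x)

/-- The space of the induced representation `Ind_H^G U`, for a finite group `G`: the functions
`f : G → U` with `f (h g) = h (f g)` for `h ∈ H`, with the norm of `⨁_{g ∈ G} U`. -/
def inducedSpace {H : Subgroup G} (U : GUniverse.{u} 𝕂 H) :
    Submodule 𝕂 (PiLp 2 fun _ : G => U.carrier) :=
  (Representation.coindV H.subtype U.rep).comap
    (WithLp.linearEquiv 2 𝕂 (G → U.carrier)).toLinearMap

/-- The space of the induced representation as a space of functions. -/
def inducedSpaceEquiv {H : Subgroup G} (U : GUniverse.{u} 𝕂 H) :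
    Representation.coindV H.subtype U.rep ≃ₗ[𝕂] U.inducedSpace where
  toFun f := ⟨WithLp.toLp 2 f.1, f.2⟩
  invFun f := ⟨WithLp.ofLp f.1, f.2⟩
  map_add' _ _ := rfl
  map_smul' _ _ := rfl
  left_inv _ := rfl
  right_inv _ := rfl

/-- The action of `G` on the induced representation: `(g f)(x) = f (x g)`. -/
def inducedRep {H : Subgroup G} (U : GUniverse.{u} 𝕂 H) :
    Representation 𝕂 G U.inducedSpace where
  toFun g := U.inducedSpaceEquiv.toLinearMap ∘ₗ
    Representation.coind H.subtype U.rep g ∘ₗ U.inducedSpaceEquiv.symm.toLinearMap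
  map_one' := by
    rw [map_one]
    rfl
  map_mul' g h := by
    rw [map_mul]
    rfl

lemma inducedRep_apply {H : Subgroup G} (U : GUniverse.{u} 𝕂 H) (g : G) (f : U.inducedSpace)
    (x : G) : (U.inducedRep g f).1 x = f.1 (x * g) := rfl

lemma inducedSpace_apply {H : Subgroup G} (U : GUniverse.{u} 𝕂 H) (f : U.inducedSpace)
    (h : H) (g : G) : f.1 (h * g) = U.rep h (f.1 g) := f.2 h g

/-- For a finite group, `inducedRep` is isomorphic to the induced representation. -/
theorem nonempty_ind_equiv_inducedRep [Finite G] {H : Subgroup G} (U : GUniverse.{u} 𝕂 H) :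
    Nonempty ((Representation.ind H.subtype U.rep).Equiv U.inducedRep) := by
  classical
  let e : (Representation.ind H.subtype U.rep).Equiv (Representation.coind H.subtype U.rep) :=
    Representation.equivOfIso (Rep.indCoindIso (Rep.of U.rep))
  exact ⟨e.trans (.mk U.inducedSpaceEquiv fun g => rfl)⟩

/-- Extension by zero of a vector of `U` to a function supported on `H`. -/
noncomputable def inducedExtend {H : Subgroup G} (U : GUniverse.{u} 𝕂 H) :
    U.carrier →ₗ[𝕂] U.inducedSpace := by
  classical
  exact
  { toFun x := ⟨WithLp.toLp 2 fun g => if h : g ∈ H then U.rep ⟨g, h⟩ x else 0, by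
      intro h g
      by_cases hg : g ∈ H
      · have h' : (h : G) * g ∈ H := H.mul_mem h.2 hg
        have h2 : (⟨(h : G) * g, h'⟩ : H) = h * ⟨g, hg⟩ := rfl
        simp [hg, h', h2]
      · have h' : (h : G) * g ∉ H := fun h' => hg ((H.mul_mem_cancel_left h.2).1 h')
        simp only [LinearEquiv.coe_coe, WithLp.linearEquiv_apply, Subgroup.subtype_apply]
        change dite _ _ _ = U.rep h (dite _ _ _)
        rw [dif_neg h', dif_neg hg, map_zero]⟩
    map_add' x y := by
      ext g
      by_cases hg : g ∈ H <;> simp [hg]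
    map_smul' c x := by
      ext g
      by_cases hg : g ∈ H <;> simp [hg] }

lemma inducedExtend_injective {H : Subgroup G} (U : GUniverse.{u} 𝕂 H) :
    Function.Injective U.inducedExtend := by
  have h1 : ∀ x, (U.inducedExtend x).1 1 = x := fun x => by
    have : (⟨1, H.one_mem⟩ : H) = 1 := rfl
    simp [inducedExtend, H.one_mem, this]
  intro x y hxy
  rw [← h1 x, ← h1 y, hxy]

/-- Induction of an `H`-universe to a `G`-universe, for a finite group `G`. The underlying
representation is the induced one, see `nonempty_ind_equiv_inducedRep`. -/
noncomputable def induce [Finite G] {H : Subgroup G} (U : GUniverse.{u} 𝕂 H) :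
    GUniverse.{max u v} 𝕂 G :=
  letI := Fintype.ofFinite G
  { carrier := U.inducedSpace
    rep := U.inducedRep
    norm_rep := by
      intro g f
      rw [← sq_eq_sq₀ (norm_nonneg _) (norm_nonneg _), Submodule.coe_norm, Submodule.coe_norm,
        PiLp.norm_sq_eq_of_L2, PiLp.norm_sq_eq_of_L2]
      exact Fintype.sum_equiv (Equiv.mulRight g) _ _ fun x => rfl
    rank_eq := by
      refine le_antisymm ?_ ?_
      · refine (Submodule.rank_le _).trans ?_
        rw [(WithLp.linearEquiv 2 𝕂 (G → U.carrier)).rank_eq, rank_pi, Cardinal.sum_const,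
          U.rank_eq, Cardinal.lift_aleph0]
        exact Cardinal.mul_le_of_le le_rfl (by simp) le_rfl
      · have := LinearMap.lift_rank_le_of_injective _ U.inducedExtend_injective
        rw [U.rank_eq, Cardinal.lift_aleph0, Cardinal.aleph0_le_lift] at this
        exact this
    exists_fixed := by
      obtain ⟨x, hx, h⟩ := U.exists_fixed
      refine ⟨⟨WithLp.toLp 2 fun _ => x, fun g _ => (h g).symm⟩, fun h0 => hx ?_, fun g => rfl⟩
      exact congrArg (fun f : U.inducedSpace => f.1 1) h0
    exists_embedding := by
      intro V hV n
      let ev : U.inducedSpace →ₗ[𝕂] U.carrier :=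
        LinearMap.proj (1 : G) ∘ₗ (WithLp.linearEquiv 2 𝕂 (G → U.carrier)).toLinearMap ∘ₗ
          U.inducedSpace.subtype
      have hev : ∀ (h : H) (f : U.inducedSpace), ev (U.inducedRep h f) = U.rep h (ev f) := by
        intro h f
        have := U.inducedSpace_apply f h 1
        rw [mul_one] at this
        change (U.inducedRep h f).1 1 = _
        rw [inducedRep_apply, one_mul, this]
        rfl
      let V' : Subrepresentation U.rep := ⟨V.toSubmodule.map ev, by
        rintro h _ ⟨f, hf, rfl⟩
        exact ⟨_, V.apply_mem_toSubmodule h hf, hev h f⟩⟩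
      have hV' : FiniteDimensional 𝕂 V'.toSubmodule :=
        inferInstanceAs (FiniteDimensional 𝕂 (V.toSubmodule.map ev))
      obtain ⟨φ, hφ, hφe⟩ := U.exists_embedding V' hV' n
      let i : V.toSubmodule →ₗ[𝕂] V'.toSubmodule := ev.restrict fun f hf => ⟨f, hf, rfl⟩
      let r : G → (Fin n → V.toSubmodule) → (Fin n → V.toSubmodule) :=
        fun g x j => V.toRepresentation g (x j)
      have hr : ∀ (h : H) g x j, i (r (h * g) x j) = V'.toRepresentation h (i (r g x j)) := by
        intro h g x j
        refine Subtype.ext ?_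
        change ev (U.inducedRep (h * g) (x j).1) = U.rep h (ev (U.inducedRep g (x j).1))
        rw [map_mul, Module.End.mul_apply, hev]
      refine ⟨{ toFun := fun x => ⟨WithLp.toLp 2 fun g => φ fun j => i (r g x j), ?_⟩
                map_add' := ?_
                map_smul' := ?_ }, ?_, ?_⟩
      · intro h g
        change φ (fun j => i (r (h * g) x j)) = U.rep h (φ fun j => i (r g x j))
        rw [← hφe]
        simp only [hr]
      · intro x y
        ext g
        change φ (fun j => i (r g (x + y) j)) =
          φ (fun j => i (r g x j)) + φ (fun j => i (r g y j))
        rw [← map_add]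
        congr 1
      · intro c x
        ext g
        change φ (fun j => i (r g (c • x) j)) = c • φ (fun j => i (r g x j))
        rw [← map_smul]
        congr 1
      · intro x y hxy
        have h1 : ∀ g, φ (fun j => i (r g x j)) = φ (fun j => i (r g y j)) := fun g =>
          congrArg (fun f : U.inducedSpace => f.1 g) hxy
        funext j
        refine Subtype.ext (Subtype.ext (PiLp.ext fun g => ?_))
        have h2 := congrArg Subtype.val (congrFun (hφ (h1 g)) j)
        have h3 : ∀ z : Fin n → V.toSubmodule, (i (r g z j)).1 = (z j).1.1 g := fun z => by
          change (U.inducedRep g (z j).1).1 1 = _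
          rw [inducedRep_apply, one_mul]
        rw [h3, h3] at h2
        exact h2
      · intro g x
        refine Subtype.ext (PiLp.ext fun g' => ?_)
        change φ (fun j => i (r g' (r g x) j)) = φ (fun j => i (r (g' * g) x j))
        congr 1
        funext j
        simp only [r, map_mul, Module.End.mul_apply] }

/-- The real universe underlying a universe over `𝕂`, by restriction of scalars; its inner product
is the real part of that of `U`. -/
noncomputable def underlyingReal (U : GUniverse.{u} 𝕂 G) : GUniverse.{u} ℝ G :=
  letI := InnerProductSpace.rclikeToReal 𝕂 U.carrier
  haveI : IsScalarTower ℝ 𝕂 U.carrier := IsScalarTower.of_algebraMap_smul fun _ _ => rfl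
  { carrier := U.carrier
    normedAddCommGroup := U.normedAddCommGroup
    innerProductSpace := InnerProductSpace.rclikeToReal 𝕂 U.carrier
    rep :=
      { toFun := fun g => (U.rep g).restrictScalars ℝ
        map_one' := by ext; simp
        map_mul' := fun g h => by ext; simp }
    norm_rep := U.norm_rep
    rank_eq := by
      have h := lift_rank_mul_lift_rank ℝ 𝕂 U.carrier
      rw [U.rank_eq, Cardinal.lift_aleph0, Cardinal.mul_eq_right le_rfl, Cardinal.lift_id'] at h
      · exact h.symm
      · simpa using (Module.rank_lt_aleph0 ℝ 𝕂).le
      · simpa using (rank_pos (R := ℝ) (M := 𝕂)).ne'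
    exists_fixed := U.exists_fixed
    exists_embedding := fun V hV n => by
      let W : Subrepresentation U.rep := ⟨Submodule.span 𝕂 V.toSubmodule, fun g => by
        change Submodule.span 𝕂 _ ≤ (Submodule.span 𝕂 _).comap (U.rep g)
        refine Submodule.span_le.2 fun v hv => ?_
        exact Submodule.subset_span (V.apply_mem_toSubmodule g hv)⟩
      have hW : FiniteDimensional 𝕂 W.toSubmodule := by
        obtain ⟨s, hs⟩ := (Module.Finite.iff_fg.1 hV : V.toSubmodule.FG)
        refine Module.Finite.iff_fg.2 ⟨s, ?_⟩
        change _ = Submodule.span 𝕂 (V.toSubmodule : Set U.carrier)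
        rw [← hs, Submodule.span_span_of_tower]
      obtain ⟨f, hf, hfe⟩ := U.exists_embedding W hW n
      let i : V.toSubmodule →ₗ[ℝ] W.toSubmodule :=
        { toFun := fun v => ⟨v.1, Submodule.subset_span v.2⟩
          map_add' := fun _ _ => rfl
          map_smul' := fun _ _ => rfl }
      refine ⟨f.restrictScalars ℝ ∘ₗ i.compLeft (Fin n), hf.comp fun x y hxy => ?_, fun g x => ?_⟩
      · funext j
        exact Subtype.ext (congrArg Subtype.val (congrFun hxy j) :)
      · exact hfe g (fun j => i (x j)) }

/-- For `𝕂 = ℝ`, passing to the underlying real universe does nothing. -/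
theorem underlyingReal_real (U : GUniverse.{u} ℝ G) : U.underlyingReal = U := by
  cases U
  rename_i E i1 i2 rep _ _ _ _
  have : InnerProductSpace.rclikeToReal ℝ E = i2 := by
    cases i2
    rfl
  simp only [underlyingReal]
  congr 1

end GUniverse

/-! ## Little discs -/

/-- A little disc in the unit disc of `E`: an affine map `x ↦ center + radius • x` with positive
radius that maps the unit disc into itself. (For `E ≠ 0`, the last condition says exactly that
`‖center‖ + radius ≤ 1`; this form also makes little discs extend to larger spaces if `E = 0`.) -/
@[ext]
structure LittleDisc (E : Type*) [NormedAddCommGroup E] [NormedSpace ℝ E] where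
  center : E
  radius : ℝ
  radius_pos : 0 < radius
  norm_center_add_radius_le : ‖center‖ + radius ≤ 1

namespace LittleDisc

variable {E F : Type*} [NormedAddCommGroup E] [NormedSpace ℝ E] [NormedAddCommGroup F]
  [NormedSpace ℝ F]

/-- The affine map of a little disc. -/
def map (d : LittleDisc E) (x : E) : E := d.center + d.radius • x

/-- The image of the unit disc. -/
def image (d : LittleDisc E) : Set E := d.map '' Metric.closedBall 0 1

lemma image_eq (d : LittleDisc E) : d.image = Metric.closedBall d.center d.radius := by
  ext x
  simp only [image, map, Set.mem_image, mem_closedBall_iff_norm, sub_zero]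
  constructor
  · rintro ⟨y, hy, rfl⟩
    rw [add_sub_cancel_left, norm_smul, Real.norm_of_nonneg d.radius_pos.le]
    exact mul_le_of_le_one_right d.radius_pos.le hy
  · intro hx
    refine ⟨d.radius⁻¹ • (x - d.center), ?_, ?_⟩
    · rw [norm_smul, norm_inv, Real.norm_of_nonneg d.radius_pos.le]
      exact (inv_mul_le_one₀ d.radius_pos).2 hx
    · rw [smul_inv_smul₀ d.radius_pos.ne', add_sub_cancel]

lemma image_subset (d : LittleDisc E) : d.image ⊆ Metric.closedBall 0 1 := by
  rw [image_eq]
  refine Metric.closedBall_subset_closedBall' ?_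
  rw [dist_zero_right, add_comm]
  exact d.norm_center_add_radius_le

lemma disjoint_image_iff (c d : LittleDisc E) :
    Disjoint c.image d.image ↔ c.radius + d.radius < ‖c.center - d.center‖ := by
  rw [image_eq, image_eq, disjoint_closedBall_closedBall_iff c.radius_pos.le d.radius_pos.le,
    dist_eq_norm]

/-- The extension of a little disc of `E` along a linear isometry `E → F`: the little disc with
the same radius and the corresponding center. -/
def extend (i : E →ₗᵢ[ℝ] F) (d : LittleDisc E) : LittleDisc F where
  center := i d.center
  radius := d.radius
  radius_pos := d.radius_pos
  norm_center_add_radius_le := by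
    rw [i.norm_map]
    exact d.norm_center_add_radius_le

/-- For an automorphism `i`, extension along `i` is conjugation by `i`. -/
lemma extend_map (i : E ≃ₗᵢ[ℝ] E) (d : LittleDisc E) (x : E) :
    (d.extend i.toLinearIsometry).map x = i (d.map (i.symm x)) := by
  simp [extend, map]

end LittleDisc

/-- The configurations of `n` disjoint little discs in the unit disc of `E`. -/
def LittleDiscs (E : Type*) [NormedAddCommGroup E] [NormedSpace ℝ E] (n : ℕ) : Type _ :=
  {d : Fin n → LittleDisc E // Pairwise fun i j => Disjoint (d i).image (d j).image}

namespace LittleDiscs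

variable {E F : Type*} [NormedAddCommGroup E] [NormedSpace ℝ E] [NormedAddCommGroup F]
  [NormedSpace ℝ F] {n : ℕ}

/-- The extension of a configuration of little discs along a linear isometry. -/
def extend (i : E →ₗᵢ[ℝ] F) (d : LittleDiscs E n) : LittleDiscs F n :=
  ⟨fun j => (d.1 j).extend i, fun j k hjk => by
    have := (LittleDisc.disjoint_image_iff _ _).1 (d.2 hjk)
    refine (LittleDisc.disjoint_image_iff _ _).2 ?_
    change (d.1 j).radius + (d.1 k).radius < ‖i (d.1 j).center - i (d.1 k).center‖
    rwa [← map_sub, i.norm_map]⟩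

/-- Relabelling of a configuration. -/
def permute (σ : Equiv.Perm (Fin n)) (d : LittleDiscs E n) : LittleDiscs E n :=
  ⟨fun j => d.1 (σ.symm j), fun _ _ hjk => d.2 (σ.symm.injective.ne hjk)⟩

end LittleDiscs

namespace GUniverse

variable {G : Type v} [Group G]

/-- The poset of finite-dimensional subrepresentations of a universe. -/
abbrev FinSub (U : GUniverse.{u} ℝ G) : Type u :=
  {V : Subrepresentation U.rep // FiniteDimensional ℝ V.toSubmodule}

instance (U : GUniverse.{u} ℝ G) : Nonempty U.FinSub :=
  ⟨⟨⊥, inferInstanceAs (FiniteDimensional ℝ (⊥ : Submodule ℝ U.carrier))⟩⟩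

instance (U : GUniverse.{u} ℝ G) : IsDirectedOrder U.FinSub where
  directed V W := by
    have := V.2
    have := W.2
    exact ⟨⟨V.1 ⊔ W.1, inferInstanceAs
      (FiniteDimensional ℝ (V.1.toSubmodule ⊔ W.1.toSubmodule : Submodule ℝ U.carrier))⟩,
      (le_sup_left : V.1 ≤ V.1 ⊔ W.1), (le_sup_right : W.1 ≤ V.1 ⊔ W.1)⟩

/-- The action of `g` on a subrepresentation. -/
noncomputable def subIsom (U : GUniverse.{u} ℝ G) (V : U.FinSub) (g : G) :
    V.1.toSubmodule →ₗᵢ[ℝ] V.1.toSubmodule where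
  toLinearMap := V.1.toRepresentation g
  norm_map' x := U.norm_rep g x

/-- The inclusion of subrepresentations. -/
noncomputable def subInclusion (U : GUniverse.{u} ℝ G) {V W : U.FinSub} (h : V ≤ W) :
    V.1.toSubmodule →ₗᵢ[ℝ] W.1.toSubmodule where
  toLinearMap := Submodule.inclusion h
  norm_map' _ := rfl

/-- The `n`-th space of the little `V`-discs operad of a finite-dimensional subrepresentation. -/
def SubDiscs (U : GUniverse.{u} ℝ G) (n : ℕ) (V : U.FinSub) : Type u :=
  LittleDiscs V.1.toSubmodule n

/-- `G` acts on little `V`-discs by conjugation, see `LittleDisc.extend_map`, and `Σₙ` by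
permuting them. -/
noncomputable instance (U : GUniverse.{u} ℝ G) (n : ℕ) (V : U.FinSub) :
    MulAction (G × Equiv.Perm (Fin n)) (U.SubDiscs n V) where
  smul a d := (LittleDiscs.extend (U.subIsom V a.1) d).permute a.2
  one_smul d := by
    refine Subtype.ext (funext fun j => LittleDisc.ext ?_ rfl)
    refine Subtype.ext ?_
    change U.rep 1 (d.1 j).center.1 = (d.1 j).center.1
    rw [map_one, Module.End.one_apply]
  mul_smul a b d := by
    refine Subtype.ext (funext fun j => LittleDisc.ext ?_ rfl)
    exact Subtype.ext (U.rep_mul a.1 b.1 _)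

/-- The map of little discs induced by an inclusion of subrepresentations. -/
noncomputable def subDiscsMap (U : GUniverse.{u} ℝ G) (n : ℕ) (V W : U.FinSub) (h : V ≤ W) :
    U.SubDiscs n V →[G × Equiv.Perm (Fin n)] U.SubDiscs n W where
  toFun d := LittleDiscs.extend (U.subInclusion h) d
  map_smul' _ _ := rfl

instance (U : GUniverse.{u} ℝ G) (n : ℕ) :
    DirectedSystem (U.SubDiscs n) (fun _ _ h => U.subDiscsMap n _ _ h) where
  map_self _ _ := rfl
  map_map _ _ _ _ _ _ := rfl

/-- The `n`-th space of the infinite little discs operad of a real universe `U`: the colimit of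
the little `V`-discs over the finite-dimensional subrepresentations `V` of `U`, with the induced
action of `G × Σₙ`. -/
abbrev InfiniteLittleDiscs (U : GUniverse.{u} ℝ G) (n : ℕ) : Type u :=
  DirectLimit (U.SubDiscs n) (U.subDiscsMap n)

/-- Transfers of the infinite little discs operad in terms of vectors with given stabilizer. -/
lemma operadTransfer_discs_iff [Finite G] (U : GUniverse.{u} ℝ G) (K H : Subgroup G) :
    OperadTransfer U.InfiniteLittleDiscs K H ↔
      K ≤ H ∧ ∃ x : U.carrier, ∀ h ∈ H, U.rep h x = x ↔ h ∈ K := by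
  refine and_congr_right fun hKH => ⟨?_, ?_⟩
  · rintro ⟨n, e, x, hx⟩
    induction x using DirectLimit.induction with
    | ih V d =>
    let q : H → H ⧸ K.subgroupOf H := fun h => h
    refine ⟨(d.1 (e (q 1))).center, fun h hh => ?_⟩
    obtain ⟨W, hVW, hVW', hW⟩ := Quotient.eq.mp (hx ⟨h, hh⟩)
    have h1 : U.rep h (d.1 (e (q 1))).center = (d.1 (e (q ⟨h, hh⟩))).center := by
      have h2 := congrArg (fun f => ((f.1 (e (q ⟨h, hh⟩))).center : U.carrier)) hW
      refine Eq.trans ?_ h2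
      change _ = U.rep h (d.1 ((e.permCongr (MulAction.toPerm (⟨h, hh⟩ : H))).symm
        (e (q ⟨h, hh⟩)))).center
      have h3 : (e.permCongr (MulAction.toPerm (⟨h, hh⟩ : H))).symm (e (q ⟨h, hh⟩)) =
          e (q 1) := by
        rw [Equiv.symm_apply_eq, Equiv.permCongr_apply, Equiv.symm_apply_apply]
        congr 1
        change q ⟨h, hh⟩ = q (⟨h, hh⟩ * 1)
        rw [mul_one]
      rw [h3]
    rw [h1]
    have h4 : h ∈ K ↔ q ⟨h, hh⟩ = q 1 := by
      rw [eq_comm]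
      refine Iff.trans ?_ QuotientGroup.eq.symm
      simp [Subgroup.mem_subgroupOf]
    rw [h4]
    constructor
    · intro h5
      by_contra h6
      have h7 := (LittleDisc.disjoint_image_iff _ _).1 (d.2 (e.injective.ne h6))
      rw [Subtype.ext h5, sub_self, norm_zero] at h7
      linarith [(d.1 (e (q 1))).radius_pos, (d.1 (e (q ⟨h, hh⟩))).radius_pos]
    · intro h5
      rw [h5]
  · rintro ⟨x, hx⟩
    let q : H → H ⧸ K.subgroupOf H := fun h => h
    obtain ⟨c, hc, hcx⟩ : ∃ c : ℝ, 0 < c ∧ c * ‖x‖ ≤ 1 / 2 := by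
      refine ⟨1 / (2 * (‖x‖ + 1)), by positivity, ?_⟩
      rw [div_mul_eq_mul_div, div_le_div_iff₀ (by positivity) (by norm_num)]
      linarith [norm_nonneg x]
    let p : H ⧸ K.subgroupOf H → U.carrier := fun a => c • U.rep (a.out : H) x
    have hp : ∀ h : H, p (q h) = c • U.rep h x := fun h => by
      have h1 : ((q h).out)⁻¹ * h ∈ K.subgroupOf H := QuotientGroup.eq.1 (Quotient.out_eq (q h))
      have h2 := (hx _ (((q h).out)⁻¹ * h).2).2 h1
      change c • _ = _
      congr 1
      conv_lhs => rw [← h2]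
      rw [← rep_mul]
      simp
    have hpq : ∀ a b, p a = p b → a = b := by
      intro a b
      obtain ⟨a, rfl⟩ := QuotientGroup.mk_surjective a
      obtain ⟨b, rfl⟩ := QuotientGroup.mk_surjective b
      intro hab
      have hab' := ((hp a).symm.trans (hab.trans (hp b)))
      have h1 := smul_right_injective _ hc.ne' hab'
      refine QuotientGroup.eq.2 ((hx _ (a⁻¹ * b).2).1 ?_)
      rw [Subgroup.coe_mul, rep_mul, ← show U.rep a x = U.rep b x from h1]
      simp
    have hact : ∀ (h : H) a, p (h • a) = U.rep h (p a) := by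
      intro h a
      obtain ⟨a, rfl⟩ := QuotientGroup.mk_surjective a
      refine (hp (h * a)).trans ?_
      rw [Subgroup.coe_mul, rep_mul, ← map_smul]
      exact congrArg _ (hp a).symm
    have hnorm : ∀ a, ‖p a‖ ≤ 1 / 2 := by
      intro a
      rw [norm_smul, U.norm_rep, Real.norm_of_nonneg hc.le]
      exact hcx
    obtain ⟨r, hr, hr', hr''⟩ : ∃ r : ℝ, 0 < r ∧ r ≤ 1 / 2 ∧
        ∀ a b, a ≠ b → r + r < ‖p a - p b‖ := by
      have h1 : ∀ᶠ r in nhdsWithin (0 : ℝ) (Set.Ioi 0), ∀ a b, a ≠ b → r + r < ‖p a - p b‖ := by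
        refine Filter.eventually_all.2 fun a => Filter.eventually_all.2 fun b => ?_
        by_cases hab : a = b
        · simp [hab]
        · have h2 : 0 < ‖p a - p b‖ := norm_pos_iff.2 (sub_ne_zero.2 fun h => hab (hpq _ _ h))
          filter_upwards [Ioo_mem_nhdsGT (half_pos h2)] with r hr _
          linarith [hr.2]
      obtain ⟨r, h2, h3⟩ := (h1.and (Ioo_mem_nhdsGT (show (0 : ℝ) < 1 / 2 by norm_num))).exists
      exact ⟨r, h3.1, h3.2.le, h2⟩
    let V : U.FinSub := ⟨U.orbitSpan (Submodule.span ℝ {x}), inferInstance⟩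
    have hpV : ∀ a, p a ∈ V.1.toSubmodule := fun a =>
      V.1.toSubmodule.smul_mem c (V.1.apply_mem_toSubmodule _
        (U.le_orbitSpan _ (Submodule.mem_span_singleton_self x)))
    let e := Finite.equivFin (H ⧸ K.subgroupOf H)
    let d : U.SubDiscs _ V := ⟨fun j => ⟨⟨p (e.symm j), hpV _⟩, r, hr, by
        have := hnorm (e.symm j)
        rw [Submodule.coe_norm]
        linarith⟩, fun i j hij => by
      refine (LittleDisc.disjoint_image_iff _ _).2 ?_
      exact hr'' _ _ (e.symm.injective.ne hij)⟩
    refine ⟨_, e, ⟦⟨V, d⟩⟧, fun h => ?_⟩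
    refine congrArg (fun d => (⟦⟨V, d⟩⟧ : U.InfiniteLittleDiscs _)) (?_ : _ • d = d)
    refine Subtype.ext (funext fun j => LittleDisc.ext (Subtype.ext ?_) rfl)
    change U.rep h (p (e.symm ((e.permCongr (MulAction.toPerm h)).symm j))) = p (e.symm j)
    rw [← hact]
    congr 1
    rw [← MulAction.toPerm_apply, ← Equiv.apply_eq_iff_eq e, ← Equiv.permCongr_apply,
      Equiv.apply_symm_apply, Equiv.apply_symm_apply]

/-- The transfer system `𝒟(U)` of the infinite little discs operad of a real universe `U`. -/
def discsReal [Finite G] (U : GUniverse.{u} ℝ G) : TransferSystem G where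
  rel K H := OperadTransfer U.InfiniteLittleDiscs K H
  refl H := (U.operadTransfer_discs_iff H H).2 ⟨le_rfl, 0, by simp⟩
  trans {L K H} h₁ h₂ := by
    rw [operadTransfer_discs_iff] at *
    obtain ⟨hLK, w, hw⟩ := h₁
    obtain ⟨hKH, v, hv⟩ := h₂
    obtain ⟨ε, hε, hε'⟩ : ∃ ε : ℝ, 0 < ε ∧ ∀ h : G, U.rep h v ≠ v →
        ε * ‖U.rep h w - w‖ < ‖U.rep h v - v‖ := by
      have h1 : ∀ᶠ ε in nhdsWithin (0 : ℝ) (Set.Ioi 0), ∀ h : G, U.rep h v ≠ v →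
          ε * ‖U.rep h w - w‖ < ‖U.rep h v - v‖ := by
        refine Filter.eventually_all.2 fun h => ?_
        by_cases hh : U.rep h v = v
        · simp [hh]
        · have h2 : 0 < ‖U.rep h v - v‖ := norm_pos_iff.2 (sub_ne_zero.2 hh)
          have h3 : Filter.Tendsto (fun ε : ℝ => ε * ‖U.rep h w - w‖)
              (nhdsWithin (0 : ℝ) (Set.Ioi 0)) (nhds 0) := by
            refine Filter.Tendsto.mono_left ?_ nhdsWithin_le_nhds
            exact (continuous_mul_const _).tendsto' _ _ (zero_mul _)
          filter_upwards [h3.eventually_lt_const h2] with ε hε _ using hε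
      obtain ⟨ε, h2, h3⟩ := (h1.and self_mem_nhdsWithin).exists
      exact ⟨ε, h3, h2⟩
    refine ⟨hLK.trans hKH, v + ε • w, fun h hh => ⟨fun heq => ?_, fun hL => ?_⟩⟩
    · rw [map_add, map_smul] at heq
      have h1 : U.rep h v - v = ε • (w - U.rep h w) := by
        rw [smul_sub, sub_eq_sub_iff_add_eq_add, heq, add_comm]
      by_cases h2 : U.rep h v = v
      · refine (hw h ((hv h hh).1 h2)).1 ?_
        rw [h2, sub_self, eq_comm, smul_eq_zero_iff_right hε.ne', sub_eq_zero] at h1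
        exact h1.symm
      · have h3 := hε' h h2
        rw [h1, norm_smul, Real.norm_of_nonneg hε.le, norm_sub_rev] at h3
        exact absurd h3 (lt_irrefl _)
    · rw [map_add, map_smul, (hv h hh).2 (hLK hL), (hw h (hLK hL)).2 hL]
  le_of_rel h := h.1
  restrict {L H K} h hK := by
    rw [operadTransfer_discs_iff] at *
    obtain ⟨_, v, hv⟩ := h
    refine ⟨inf_le_left, v, fun h hh => ?_⟩
    rw [hv h (hK hh), Subgroup.mem_inf]
    exact ⟨fun h' => ⟨hh, h'⟩, fun h' => h'.2⟩
  conj {K H} g h := by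
    rw [operadTransfer_discs_iff] at *
    obtain ⟨hKH, v, hv⟩ := h
    refine ⟨Subgroup.map_mono hKH, U.rep g v, fun h hh => ?_⟩
    rw [TransferSystem.mem_map_conj] at hh ⊢
    rw [← hv _ hh, rep_mul, rep_mul]
    exact ⟨fun e => by rw [e, rep_inv_rep], fun e => by simpa using congrArg (U.rep g) e⟩

/-- The transfer system `𝒟(U)` of the infinite little discs operad of a universe `U` over `ℝ` or
`ℂ`, which is by definition that of the underlying real universe. -/
noncomputable def discs {𝕂 : Type} [RCLike 𝕂] [Finite G] (U : GUniverse.{u} 𝕂 G) :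
    TransferSystem G :=
  U.underlyingReal.discsReal

end GUniverse

/-! ## Linear isometries -/

namespace GUniverse

variable {𝕂 : Type} [RCLike 𝕂] {G : Type v} [Group G]

/-- The `n`-th space of the linear isometries operad of `U`: the (not necessarily equivariant)
linear isometries from the `n`-fold direct sum of `U` to `U`. -/
def LinearIsometries (U : GUniverse.{u} 𝕂 G) (n : ℕ) : Type u :=
  (PiLp 2 fun _ : Fin n => U.carrier) →ₗᵢ[𝕂] U.carrier

/-- The isometry `x ↦ (i ↦ g⁻¹ (x (σ i)))` of the `n`-fold direct sum of `U`. -/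
noncomputable def sumIsom (U : GUniverse.{u} 𝕂 G) {n : ℕ} (g : G) (σ : Equiv.Perm (Fin n)) :
    (PiLp 2 fun _ : Fin n => U.carrier) →ₗᵢ[𝕂] (PiLp 2 fun _ : Fin n => U.carrier) where
  toFun x := WithLp.toLp 2 fun i => U.rep g⁻¹ (x (σ i))
  map_add' x y := by
    ext i
    simp
  map_smul' c x := by
    ext i
    simp
  norm_map' x := by
    rw [← sq_eq_sq₀ (norm_nonneg _) (norm_nonneg _), PiLp.norm_sq_eq_of_L2,
      PiLp.norm_sq_eq_of_L2]
    refine Fintype.sum_equiv σ _ _ fun i => ?_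
    congr 1
    exact U.norm_rep _ _

/-- The action of `G × Σₙ` on linear isometries, by conjugation and by permuting the summands. -/
noncomputable instance (U : GUniverse.{u} 𝕂 G) (n : ℕ) :
    MulAction (G × Equiv.Perm (Fin n)) (U.LinearIsometries n) where
  smul a f := (U.isom a.1).toLinearIsometry.comp (LinearIsometry.comp f (U.sumIsom a.1 a.2))
  one_smul f := by
    let f' : (PiLp 2 fun _ : Fin n => U.carrier) →ₗᵢ[𝕂] U.carrier := f
    refine LinearIsometry.ext fun x => ?_
    change U.rep 1 (f' (WithLp.toLp 2 fun i => U.rep 1⁻¹ (x i))) = f' x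
    simp
  mul_smul a b f := by
    let f' : (PiLp 2 fun _ : Fin n => U.carrier) →ₗᵢ[𝕂] U.carrier := f
    refine LinearIsometry.ext fun x => ?_
    change U.rep (a.1 * b.1) (f' (WithLp.toLp 2 fun i => U.rep (a.1 * b.1)⁻¹ (x (a.2 (b.2 i))))) =
      U.rep a.1 (U.rep b.1 (f' (WithLp.toLp 2 fun i =>
        U.rep b.1⁻¹ (U.rep a.1⁻¹ (x (a.2 (b.2 i)))))))
    simp only [mul_inv_rev, rep_mul]

lemma linearIsometries_smul_apply (U : GUniverse.{u} 𝕂 G) (n : ℕ)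
    (a : G × Equiv.Perm (Fin n)) (f : U.LinearIsometries n)
    (x : PiLp 2 fun _ : Fin n => U.carrier) :
    (show (PiLp 2 fun _ : Fin n => U.carrier) →ₗᵢ[𝕂] U.carrier from a • f) x =
      U.rep a.1 ((show (PiLp 2 fun _ : Fin n => U.carrier) →ₗᵢ[𝕂] U.carrier from f)
        (WithLp.toLp 2 fun i => U.rep a.1⁻¹ (x (a.2 i)))) := rfl

/-- Transfers of the linear isometries operad in terms of a single linear isometry. -/
lemma operadTransfer_isometries_iff [Finite G] (U : GUniverse.{u} 𝕂 G) (K H : Subgroup G) :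
    OperadTransfer U.LinearIsometries K H ↔
      K ≤ H ∧ ∃ j : U.carrier →ₗᵢ[𝕂] U.carrier, (∀ k ∈ K, ∀ x, j (U.rep k x) = U.rep k (j x)) ∧
        ∀ h ∈ H, h ∉ K → ∀ x y, ⟪j x, U.rep h (j y)⟫_𝕂 = 0 := by
  refine and_congr_right fun hKH => ⟨?_, ?_⟩
  · rintro ⟨n, e, f, hf⟩
    let f' : (PiLp 2 fun _ : Fin n => U.carrier) →ₗᵢ[𝕂] U.carrier := f
    let q : H → H ⧸ K.subgroupOf H := fun h => h
    have hq : ∀ h : H, (h : G) ∈ K ↔ q h = q 1 := fun h => by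
      rw [eq_comm]
      refine Iff.trans ?_ QuotientGroup.eq.symm
      simp [Subgroup.mem_subgroupOf]
    let s : Fin n → U.carrier →ₗᵢ[𝕂] (PiLp 2 fun _ : Fin n => U.carrier) := fun i =>
      { toFun := fun x => PiLp.single 2 i x
        map_add' := fun x y => PiLp.single_add 2 i
        map_smul' := fun c x => by
          ext k
          by_cases hk : k = i
          · subst hk
            simp
          · simp [hk]
        norm_map' := fun x => PiLp.norm_single 2 (fun _ : Fin n => U.carrier) i x }
    have key : ∀ (h : H) x, U.rep h (f' (s (e (q 1)) x)) = f' (s (e (q h)) (U.rep h x)) := by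
      intro h x
      have h1 := linearIsometries_smul_apply U n
        ((h : G), e.permCongr (MulAction.toPerm h)) f (s (e (q h)) (U.rep h x))
      rw [hf h] at h1
      refine (Eq.trans h1 ?_).symm
      change U.rep h (f' _) = _
      congr 2
      refine PiLp.ext fun i => ?_
      change U.rep (h : G)⁻¹ (Pi.single (M := fun _ => U.carrier) (e (q h)) (U.rep h x)
        (e (h • e.symm i))) = Pi.single (M := fun _ => U.carrier) (e (q 1)) x i
      have h2 : h • q 1 = q h := congrArg q (mul_one h)
      by_cases hi : i = e (q 1)
      · subst hi
        rw [Equiv.symm_apply_apply, h2, Pi.single_eq_same, Pi.single_eq_same, rep_inv_rep]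
      · rw [Pi.single_eq_of_ne hi, Pi.single_eq_of_ne, map_zero]
        rw [← h2]
        intro h3
        apply hi
        rw [← smul_left_cancel h (e.injective h3), Equiv.apply_symm_apply]
    refine ⟨f'.comp (s (e (q 1))), fun k hk x => ?_, fun h hh hK x y => ?_⟩
    · refine (Eq.trans (key ⟨k, hKH hk⟩ x) ?_).symm
      rw [(hq _).1 hk]
      rfl
    · refine (congrArg (fun z => ⟪f' (s (e (q 1)) x), z⟫_𝕂) (key ⟨h, hh⟩ y)).trans ?_
      refine (f'.inner_map_map _ _).trans ?_
      rw [PiLp.inner_apply]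
      refine Finset.sum_eq_zero fun i _ => ?_
      change ⟪Pi.single (M := fun _ => U.carrier) (e (q 1)) x i,
        Pi.single (M := fun _ => U.carrier) (e (q ⟨h, hh⟩)) (U.rep h y) i⟫_𝕂 = 0
      by_cases hi : i = e (q 1)
      · rw [Pi.single_eq_of_ne (i := e (q ⟨h, hh⟩)), inner_zero_right]
        rintro rfl
        exact hK ((hq _).2 (e.injective hi))
      · rw [Pi.single_eq_of_ne hi, inner_zero_left]
  · rintro ⟨j, hj, hj'⟩
    let q : H → H ⧸ K.subgroupOf H := fun h => h
    let e := Finite.equivFin (H ⧸ K.subgroupOf H)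
    let t : H → U.carrier →ₗᵢ[𝕂] U.carrier := fun h =>
      (U.isom h).toLinearIsometry.comp (j.comp (U.isom (h : G)⁻¹).toLinearIsometry)
    have ht : ∀ h x, t h x = U.rep h (j (U.rep (h : G)⁻¹ x)) := fun h x => rfl
    let T : H ⧸ K.subgroupOf H → U.carrier →ₗᵢ[𝕂] U.carrier := fun a => t a.out
    have hT : ∀ h x, T (q h) x = t h x := fun h x => by
      have h1 : ((q h).out : G)⁻¹ * h ∈ K :=
        Subgroup.mem_subgroupOf.1 (QuotientGroup.eq.1 (Quotient.out_eq (q h)))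
      change t _ x = _
      rw [ht, ht]
      have h2 := hj _ h1 (U.rep (h : G)⁻¹ x)
      rw [← rep_mul, mul_assoc, mul_inv_cancel, mul_one] at h2
      rw [h2, ← rep_mul, mul_inv_cancel_left]
    have hsmul : ∀ (h : H) a x, U.rep h (T a (U.rep (h : G)⁻¹ x)) = T (h • a) x := by
      intro h a x
      obtain ⟨a, rfl⟩ := QuotientGroup.mk_surjective a
      refine Eq.trans ?_ (hT (h * a) x).symm
      refine (congrArg (U.rep h) (hT a _)).trans ?_
      rw [ht, ht, Subgroup.coe_mul, mul_inv_rev, rep_mul, rep_mul]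
    have horth : OrthogonalFamily 𝕂 (fun _ : Fin (Nat.card (H ⧸ K.subgroupOf H)) => U.carrier)
        (fun i => T (e.symm i)) := by
      intro a b hab x y
      have h1 : (((e.symm a).out : H) : G)⁻¹ * ((e.symm b).out : H) ∉ K := fun h2 => by
        apply hab
        apply e.symm.injective
        have h3 := QuotientGroup.eq.2 (show ((e.symm a).out)⁻¹ * (e.symm b).out ∈
          K.subgroupOf H from h2)
        rwa [QuotientGroup.out_eq', QuotientGroup.out_eq'] at h3
      have h2 := hj' _ (H.mul_mem (H.inv_mem ((e.symm a).out).2) ((e.symm b).out).2) h1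
        (U.rep (((e.symm a).out : H) : G)⁻¹ x) (U.rep (((e.symm b).out : H) : G)⁻¹ y)
      rw [← U.inner_rep ((e.symm a).out : H), ← rep_mul, mul_inv_cancel_left] at h2
      exact h2
    let f : (PiLp 2 fun _ : Fin (Nat.card (H ⧸ K.subgroupOf H)) => U.carrier) →ₗᵢ[𝕂] U.carrier :=
      { toFun := fun x => ∑ i, T (e.symm i) (x i)
        map_add' := fun x y => by simp [Finset.sum_add_distrib]
        map_smul' := fun c x => by simp [Finset.smul_sum]
        norm_map' := fun x => by
          change ‖∑ i, T (e.symm i) (x i)‖ = _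
          rw [← sq_eq_sq₀ (norm_nonneg _) (norm_nonneg _), PiLp.norm_sq_eq_of_L2]
          exact horth.norm_sum (fun i => x i) Finset.univ }
    refine ⟨_, e, f, fun h => LinearIsometry.ext fun x => ?_⟩
    change U.rep h (∑ i, T (e.symm i) (U.rep (h : G)⁻¹ (x (e (h • e.symm i))))) =
      ∑ i, T (e.symm i) (x i)
    rw [map_sum]
    refine Fintype.sum_equiv (e.permCongr (MulAction.toPerm h)) _ _ fun i => ?_
    rw [hsmul]
    change _ = T (e.symm (e (h • e.symm i))) (x (e (h • e.symm i)))
    rw [Equiv.symm_apply_apply]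

/-- The transfer system of the linear isometries operad of `U`. -/
noncomputable def linearIsometries [Finite G] (U : GUniverse.{u} 𝕂 G) : TransferSystem G where
  rel K H := OperadTransfer U.LinearIsometries K H
  refl H := (U.operadTransfer_isometries_iff H H).2
    ⟨le_rfl, LinearIsometry.id, fun _ _ _ => rfl, fun h hh hh' => absurd hh hh'⟩
  trans {L K H} h₁ h₂ := by
    rw [operadTransfer_isometries_iff] at *
    obtain ⟨hLK, i, hi, hi'⟩ := h₁
    obtain ⟨hKH, j, hj, hj'⟩ := h₂
    refine ⟨hLK.trans hKH, j.comp i, fun l hl x => ?_, fun h hh hL x y => ?_⟩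
    · simp only [LinearIsometry.coe_comp, Function.comp_apply]
      rw [hi l hl, hj l (hLK hl)]
    · simp only [LinearIsometry.coe_comp, Function.comp_apply]
      by_cases hK : h ∈ K
      · rw [← hj h hK, j.inner_map_map, hi' h hK hL]
      · exact hj' h hh hK _ _
  le_of_rel h := h.1
  restrict {L H K} h hK := by
    rw [operadTransfer_isometries_iff] at *
    obtain ⟨_, j, hj, hj'⟩ := h
    exact ⟨inf_le_left, j, fun k hk => hj k hk.2,
      fun h hh hL => hj' h (hK hh) fun h' => hL ⟨hh, h'⟩⟩
  conj {K H} g h := by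
    rw [operadTransfer_isometries_iff] at *
    obtain ⟨hKH, j, hj, hj'⟩ := h
    refine ⟨Subgroup.map_mono hKH, (U.isom g).toLinearIsometry.comp
      (j.comp (U.isom g⁻¹).toLinearIsometry), fun k hk x => ?_, fun h hh hK x y => ?_⟩
    · rw [TransferSystem.mem_map_conj] at hk
      have h1 := hj _ hk (U.rep g⁻¹ x)
      change U.rep g (j (U.rep g⁻¹ (U.rep k x))) = U.rep k (U.rep g (j (U.rep g⁻¹ x)))
      rw [← rep_mul, mul_inv_cancel_right, rep_mul] at h1
      rw [h1, ← rep_mul, ← rep_mul]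
      simp [mul_assoc]
    · rw [TransferSystem.mem_map_conj] at hh hK
      have h1 := hj' _ hh hK (U.rep g⁻¹ x) (U.rep g⁻¹ y)
      rw [← U.inner_rep g, ← rep_mul] at h1
      change ⟪U.rep g (j (U.rep g⁻¹ x)), U.rep h (U.rep g (j (U.rep g⁻¹ y)))⟫_𝕂 = 0
      rw [← rep_mul]
      simpa [mul_assoc] using h1

/-- Embeddings of an induced representation `Ind_S^Γ Res ρ → ρ` in terms of linear
endomorphisms. -/
lemma exists_injective_ind_iff {Γ : Type v} [Group Γ] [Finite Γ] (S : Subgroup Γ) {V : Type u}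
    [AddCommGroup V] [Module 𝕂 V] (ρ : Representation 𝕂 Γ V) :
    (∃ f : (Representation.ind S.subtype (ρ.comp S.subtype)).IntertwiningMap ρ,
      Function.Injective f) ↔
    ∃ j q : V →ₗ[𝕂] V, (∀ s ∈ S, ∀ x, j (ρ s x) = ρ s (j x)) ∧
      (∀ s ∈ S, ∀ x, q (ρ s x) = ρ s (q x)) ∧ (∀ x, q (j x) = x) ∧
      ∀ g ∉ S, ∀ x, q (ρ g (j x)) = 0 := by
  classical
  have := Fintype.ofFinite Γ
  have hmul : ∀ g h x, ρ g (ρ h x) = ρ (g * h) x := fun g h x => by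
    rw [map_mul, Module.End.mul_apply]
  let e : (Representation.ind S.subtype (ρ.comp S.subtype)).Equiv
      (Representation.coind S.subtype (ρ.comp S.subtype)) :=
    Representation.equivOfIso (Rep.indCoindIso (Rep.of (ρ.comp S.subtype)))
  let m : V →ₗ[𝕂] Representation.IndV S.subtype (ρ.comp S.subtype) :=
    Representation.IndV.mk S.subtype (ρ.comp S.subtype) 1
  have he : ∀ a g, (e (m a)).1 g =
      Rep.indToCoindAux (Rep.of (ρ.comp S.subtype)) 1 a g := by
    intro a g
    change (Rep.indToCoind (Rep.of (ρ.comp S.subtype)) (m a)).1 g = _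
    simp only [m, Rep.indToCoind, LinearMap.coe_comp, Function.comp_apply,
      Representation.Coinvariants.lift_mk, TensorProduct.mk_apply, TensorProduct.lift.tmul]
    simp
    rfl
  have he0 : ∀ a, ∀ g ∉ S, (e (m a)).1 g = 0 := by
    intro a g hg
    rw [he]
    refine Rep.indToCoindAux_of_not_rel _ _ _ ?_
    rintro ⟨s, rfl⟩
    exact hg (S.mul_mem s.2 S.one_mem)
  have he1 : ∀ a, ∀ g ∈ S, (e (m a)).1 g = ρ g a := by
    intro a g hg
    have h1 := (e (m a)).2 ⟨g, hg⟩ 1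
    rw [he a 1, Rep.indToCoindAux_self] at h1
    refine Eq.trans ?_ h1
    change (e (m a)).1 g = (e (m a)).1 (g * 1)
    rw [mul_one]
  have hm : ∀ s ∈ S, ∀ a, m (ρ s a) =
      Representation.ind S.subtype (ρ.comp S.subtype) s (m a) := by
    intro s hs a
    apply e.injective
    refine Subtype.ext (funext fun g => ?_)
    have hee : e (Representation.ind S.subtype (ρ.comp S.subtype) s (m a)) =
        Representation.coind S.subtype (ρ.comp S.subtype) s (e (m a)) :=
      LinearMap.congr_fun (e.isIntertwining' s) (m a)
    refine Eq.trans ?_ (congrArg (fun φ => φ.1 g) hee).symm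
    change (e (m (ρ s a))).1 g = (e (m a)).1 (g * s)
    by_cases hg : g ∈ S
    · rw [he1 _ _ hg, he1 _ _ (S.mul_mem hg hs), hmul]
    · rw [he0 _ _ hg, he0 _ _ fun h => hg ((S.mul_mem_cancel_right hs).1 h)]
  constructor
  · rintro ⟨f, hf⟩
    obtain ⟨p, hp⟩ := f.toLinearMap.exists_leftInverse_of_injective (LinearMap.ker_eq_bot.2 hf)
    have hp' : ∀ x, p (f x) = x := fun x => LinearMap.congr_fun hp x
    have hfe : ∀ g x, ρ g (f x) = f (Representation.ind S.subtype (ρ.comp S.subtype) g x) :=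
      fun g x => (LinearMap.congr_fun (f.isIntertwining' g) x).symm
    have hee : ∀ g x, e (Representation.ind S.subtype (ρ.comp S.subtype) g x) =
        Representation.coind S.subtype (ρ.comp S.subtype) g (e x) :=
      fun g x => LinearMap.congr_fun (e.isIntertwining' g) x
    let q0 : V →ₗ[𝕂] V := LinearMap.proj (1 : Γ) ∘ₗ
      (Representation.coindV S.subtype (ρ.comp S.subtype)).subtype ∘ₗ e.toLinearMap ∘ₗ p
    let j : V →ₗ[𝕂] V := f.toLinearMap ∘ₗ m
    have hq0 : ∀ g x, q0 (ρ g (j x)) = (e (m x)).1 g := by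
      intro g x
      change (e (p (ρ g (f (m x))))).1 1 = _
      rw [hfe, hp', hee]
      change (e (m x)).1 (1 * g) = _
      rw [one_mul]
    let q : V →ₗ[𝕂] V := (Nat.card S : 𝕂)⁻¹ • ∑ s : S, ρ s ∘ₗ q0 ∘ₗ ρ (s : Γ)⁻¹
    have hq : ∀ x, q x = (Nat.card S : 𝕂)⁻¹ • ∑ s : S, ρ s (q0 (ρ (s : Γ)⁻¹ x)) := fun x => by
      simp [q]
    have hS : (Nat.card S : 𝕂) ≠ 0 := Nat.cast_ne_zero.2 Nat.card_pos.ne'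
    refine ⟨j, q, fun s hs x => ?_, fun s hs x => ?_, fun x => ?_, fun g hg x => ?_⟩
    · change f (m (ρ s x)) = ρ s (f (m x))
      rw [hm s hs, hfe]
    · rw [hq, hq, map_smul, map_sum]
      congr 1
      refine Fintype.sum_equiv (Equiv.mulLeft (⟨s, hs⟩⁻¹ : S)) _ _ fun t => ?_
      change ρ t (q0 (ρ (t : Γ)⁻¹ (ρ s x))) = ρ s (ρ (s⁻¹ * t) (q0 (ρ (s⁻¹ * (t : Γ))⁻¹ x)))
      rw [hmul, hmul, mul_inv_cancel_left, mul_inv_rev, inv_inv]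
    · have : ∀ s : S, ρ s (q0 (ρ (s : Γ)⁻¹ (j x))) = x := fun s => by
        rw [hq0, he1 _ _ (S.inv_mem s.2), hmul, mul_inv_cancel, map_one, Module.End.one_apply]
      rw [hq, Finset.sum_congr rfl fun s _ => this s, Finset.sum_const, Finset.card_univ,
        ← Nat.card_eq_fintype_card, ← Nat.cast_smul_eq_nsmul 𝕂, inv_smul_smul₀ hS]
    · have : ∀ s : S, ρ s (q0 (ρ (s : Γ)⁻¹ (ρ g (j x)))) = 0 := fun s => by
        rw [hmul, hq0, he0, map_zero]
        intro h
        exact hg ((S.mul_mem_cancel_left (S.inv_mem s.2)).1 h)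
      rw [hq, Finset.sum_congr rfl fun s _ => this s, Finset.sum_const_zero, smul_zero]
  · rintro ⟨j, q, hj, hq, hqj, hq0⟩
    let F : (Representation.coind S.subtype (ρ.comp S.subtype)).IntertwiningMap ρ :=
      { toLinearMap := ∑ g : Γ, ρ g⁻¹ ∘ₗ j ∘ₗ LinearMap.proj g ∘ₗ
          (Representation.coindV S.subtype (ρ.comp S.subtype)).subtype
        isIntertwining' := fun h => by
          ext φ
          simp only [LinearMap.coe_comp, Function.comp_apply, LinearMap.sum_apply, map_sum]
          refine Fintype.sum_equiv (Equiv.mulRight h) _ _ fun g => ?_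
          change ρ g⁻¹ (j (φ.1 (g * h))) = ρ h (ρ (g * h)⁻¹ (j (φ.1 (g * h))))
          rw [hmul]
          simp }
    have hF : ∀ φ, F φ = ∑ g : Γ, ρ g⁻¹ (j (φ.1 g)) := fun φ => by
      change (∑ g : Γ, ρ g⁻¹ ∘ₗ j ∘ₗ LinearMap.proj g ∘ₗ
          (Representation.coindV S.subtype (ρ.comp S.subtype)).subtype) φ = _
      rw [LinearMap.sum_apply]
      rfl
    have hFinj : Function.Injective F := by
      refine (injective_iff_map_eq_zero F).2 fun φ hφ => Subtype.ext (funext fun x => ?_)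
      have h1 : q (ρ x (F φ)) = 0 := by rw [hφ, map_zero, map_zero]
      have h2 : ∀ g, q (ρ x (ρ g⁻¹ (j (φ.1 g)))) = if x * g⁻¹ ∈ S then φ.1 x else 0 := by
        intro g
        rw [hmul]
        split_ifs with h
        · rw [hq _ h, hqj]
          have h3 := φ.2 ⟨_, h⟩ g
          change φ.1 (x * g⁻¹ * g) = ρ (x * g⁻¹) (φ.1 g) at h3
          rw [← h3, inv_mul_cancel_right]
        · exact hq0 _ h _
      rw [hF, map_sum, map_sum, Finset.sum_congr rfl fun g _ => h2 g, Finset.sum_ite,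
        Finset.sum_const_zero, add_zero, Finset.sum_const, ← Nat.cast_smul_eq_nsmul 𝕂] at h1
      refine (smul_eq_zero.1 h1).resolve_left (Nat.cast_ne_zero.2 ?_)
      refine (Finset.card_pos.2 ⟨x, ?_⟩).ne'
      simp [S.one_mem]
    exact ⟨F.comp e.toIntertwiningMap, hFinj.comp e.injective⟩

/-- `K → H` if and only if `Ind_K^H Res^G_K U` embeds `H`-equivariantly into `Res^G_H U`. -/
def EmbeddingTransfer (U : GUniverse.{u} 𝕂 G) (K H : Subgroup G) : Prop :=
  K ≤ H ∧ ∃ f : (Representation.ind (K.subgroupOf H).subtype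
      ((U.rep.comp H.subtype).comp (K.subgroupOf H).subtype)).IntertwiningMap
        (U.rep.comp H.subtype), Function.Injective f

lemma embeddingTransfer_iff [Finite G] (U : GUniverse.{u} 𝕂 G) (K H : Subgroup G) :
    U.EmbeddingTransfer K H ↔ K ≤ H ∧ ∃ j q : U.carrier →ₗ[𝕂] U.carrier,
      (∀ k ∈ K, ∀ x, j (U.rep k x) = U.rep k (j x)) ∧
      (∀ k ∈ K, ∀ x, q (U.rep k x) = U.rep k (q x)) ∧ (∀ x, q (j x) = x) ∧
      ∀ h ∈ H, h ∉ K → ∀ x, q (U.rep h (j x)) = 0 := by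
  refine and_congr_right fun hKH => ?_
  refine (exists_injective_ind_iff (K.subgroupOf H) (U.rep.comp H.subtype)).trans ?_
  refine exists_congr fun j => exists_congr fun q => ?_
  refine and_congr ?_ (and_congr ?_ (and_congr_right fun _ => ?_))
  · exact ⟨fun h k hk => h ⟨k, hKH hk⟩ hk, fun h k hk => h k hk⟩
  · exact ⟨fun h k hk => h ⟨k, hKH hk⟩ hk, fun h k hk => h k hk⟩
  · exact ⟨fun h k hk hk' => h ⟨k, hk⟩ hk', fun h k hk => h k k.2 hk⟩

/-- The transfer system in which `K → H` if and only if `Ind_K^H Res^G_K U` embeds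
`H`-equivariantly into `Res^G_H U`. -/
noncomputable def linearEmbeddings [Finite G] (U : GUniverse.{u} 𝕂 G) : TransferSystem G where
  rel K H := U.EmbeddingTransfer K H
  refl H := (U.embeddingTransfer_iff H H).2 ⟨le_rfl, LinearMap.id, LinearMap.id, fun _ _ _ => rfl,
    fun _ _ _ => rfl, fun _ => rfl, fun h hh hh' => absurd hh hh'⟩
  trans {L K H} h₁ h₂ := by
    rw [embeddingTransfer_iff] at *
    obtain ⟨hLK, i, p, hi, hp, hpi, hpi'⟩ := h₁
    obtain ⟨hKH, j, q, hj, hq, hqj, hqj'⟩ := h₂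
    refine ⟨hLK.trans hKH, j ∘ₗ i, p ∘ₗ q, fun l hl x => ?_, fun l hl x => ?_, fun x => ?_,
      fun h hh hL x => ?_⟩ <;> simp only [LinearMap.coe_comp, Function.comp_apply]
    · rw [hi l hl, hj l (hLK hl)]
    · rw [hq l (hLK hl), hp l hl]
    · rw [hqj, hpi]
    · by_cases hK : h ∈ K
      · rw [hq h hK, hqj, hpi' h hK hL]
      · rw [hqj' h hh hK, map_zero]
  le_of_rel h := h.1
  restrict {L H K} h hK := by
    rw [embeddingTransfer_iff] at *
    obtain ⟨_, j, q, hj, hq, hqj, hqj'⟩ := h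
    exact ⟨inf_le_left, j, q, fun k hk => hj k hk.2, fun k hk => hq k hk.2, hqj,
      fun h hh hL => hqj' h (hK hh) fun h' => hL ⟨hh, h'⟩⟩
  conj {K H} g h := by
    rw [embeddingTransfer_iff] at *
    obtain ⟨hKH, j, q, hj, hq, hqj, hqj'⟩ := h
    have aux : ∀ i : U.carrier →ₗ[𝕂] U.carrier, (∀ k ∈ K, ∀ x, i (U.rep k x) = U.rep k (i x)) →
        ∀ k ∈ K.map (MulAut.conj g).toMonoidHom, ∀ x,
          U.rep g (i (U.rep g⁻¹ (U.rep k x))) = U.rep k (U.rep g (i (U.rep g⁻¹ x))) := by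
      intro i hi k hk x
      rw [TransferSystem.mem_map_conj] at hk
      have h1 := hi _ hk (U.rep g⁻¹ x)
      rw [← rep_mul, mul_inv_cancel_right, rep_mul] at h1
      rw [h1, ← rep_mul, ← rep_mul]
      simp [mul_assoc]
    refine ⟨Subgroup.map_mono hKH, U.rep g ∘ₗ j ∘ₗ U.rep g⁻¹, U.rep g ∘ₗ q ∘ₗ U.rep g⁻¹,
      aux j hj, aux q hq, fun x => ?_, fun h hh hK x => ?_⟩ <;>
      simp only [LinearMap.coe_comp, Function.comp_apply]
    · rw [rep_inv_rep, hqj, rep_rep_inv]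
    · rw [TransferSystem.mem_map_conj] at hh hK
      have h1 := hqj' _ hh hK (U.rep g⁻¹ x)
      rw [rep_mul, rep_mul] at h1
      rw [h1, map_zero]

end GUniverse

/-!
Every clause about `𝒟` reduces to a statement about stabilizers: `K → H` in `𝒟(U)` if and only if
`K ≤ H` and some vector of `U` has stabilizer `K` in `H` (`GUniverse.discs_rel_iff`). Likewise the
two versions of `ℒ` have descriptions by linear endomorphisms of `U` that only involve the action
of `H`, so that restriction to subgroups is immediate. For fixed points, a vector whose stabilizer
contains `N` lies in `U^N`. For inflation, the transfer `K/N → H/N` that induces `M → L` is given by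
`H = LN` and the stabilizer `K` in `H` of a vector whose stabilizer in `L` is `M`.

For induction, elements of `Ind_H^G U` are functions `f : G → U` with `f (h g) = h (f g)`.
If `G` is abelian, then an element of `H` fixes `f` if and only if it fixes all values of `f`, and as
`U` contains multiples of its finite-dimensional subrepresentations, the common stabilizer of
finitely many vectors is the stabilizer of a single vector
(`GUniverse.exists_fixed_iff_forall_fixed`). Conversely, let `x ≠ 0` be a vector whose stabilizer
in `K ∩ H` is `L ∩ H`. Extend `x` by zero to a function supported on `H` and sum its translates
under `L`. The resulting function is invariant under `L`, is supported on `HL` and takes a nonzero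
multiple of `x` as its value at `1`, whence its stabilizer in `K` is `L`
(`GUniverse.discs_induce_rel_of_discs_rel`).
-/

namespace GUniverse

variable {𝕂 : Type} [RCLike 𝕂] {G : Type v} [Group G]

/-- The transfers of the little discs operad are the inclusions of stabilizers of vectors. -/
lemma discs_rel_iff [Finite G] (U : GUniverse.{u} 𝕂 G) (K H : Subgroup G) :
    U.discs.rel K H ↔ K ≤ H ∧ ∃ x : U.carrier, ∀ h ∈ H, U.rep h x = x ↔ h ∈ K :=
  U.underlyingReal.operadTransfer_discs_iff K H

/-! ### Restriction -/

lemma discs_res [Finite G] (U : GUniverse.{u} 𝕂 G) (H : Subgroup G) :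
    (U.res H).discs = U.discs.res H := by
  ext K J
  change _ ↔ U.discs.rel _ _
  rw [discs_rel_iff, discs_rel_iff, Subgroup.map_le_map_iff_of_injective H.subtype_injective]
  refine and_congr_right fun _ => exists_congr fun x => ?_
  constructor
  · rintro h _ ⟨j, hj, rfl⟩
    exact (h j hj).trans (Subgroup.mem_map_iff_mem H.subtype_injective).symm
  · intro h j hj
    exact (h j ⟨j, hj, rfl⟩).trans (Subgroup.mem_map_iff_mem H.subtype_injective)

lemma linearIsometries_res [Finite G] (U : GUniverse.{u} 𝕂 G) (H : Subgroup G) :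
    (U.res H).linearIsometries = U.linearIsometries.res H := by
  ext K J
  change OperadTransfer _ _ _ ↔ OperadTransfer U.LinearIsometries _ _
  rw [operadTransfer_isometries_iff, operadTransfer_isometries_iff,
    Subgroup.map_le_map_iff_of_injective H.subtype_injective]
  refine and_congr_right fun _ => exists_congr fun j => and_congr ?_ ?_
  · constructor
    · rintro h _ ⟨k, hk, rfl⟩
      exact h k hk
    · exact fun h k hk => h k ⟨k, hk, rfl⟩
  · constructor
    · rintro h _ ⟨g, hg, rfl⟩ hK
      exact h g hg fun hgK => hK ⟨g, hgK, rfl⟩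
    · exact fun h g hg hK =>
        h g ⟨g, hg, rfl⟩ fun hgK => hK ((Subgroup.mem_map_iff_mem H.subtype_injective).1 hgK)

lemma linearEmbeddings_res [Finite G] (U : GUniverse.{u} 𝕂 G) (H : Subgroup G) :
    (U.res H).linearEmbeddings = U.linearEmbeddings.res H := by
  ext K J
  change EmbeddingTransfer _ _ _ ↔ U.EmbeddingTransfer _ _
  rw [embeddingTransfer_iff, embeddingTransfer_iff,
    Subgroup.map_le_map_iff_of_injective H.subtype_injective]
  refine and_congr_right fun _ => exists_congr fun j => exists_congr fun q =>
    and_congr ?_ (and_congr ?_ (and_congr_right fun _ => ?_))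
  · constructor
    · rintro h _ ⟨k, hk, rfl⟩
      exact h k hk
    · exact fun h k hk => h k ⟨k, hk, rfl⟩
  · constructor
    · rintro h _ ⟨k, hk, rfl⟩
      exact h k hk
    · exact fun h k hk => h k ⟨k, hk, rfl⟩
  · constructor
    · rintro h _ ⟨g, hg, rfl⟩ hK
      exact h g hg fun hgK => hK ⟨g, hgK, rfl⟩
    · exact fun h g hg hK =>
        h g ⟨g, hg, rfl⟩ fun hgK => hK ((Subgroup.mem_map_iff_mem H.subtype_injective).1 hgK)

/-! ### Fixed points and inflation -/

lemma discs_fixedPoints [Finite G] (U : GUniverse.{u} 𝕂 G) (N : Subgroup G) [N.Normal] :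
    U.discs.fixedPoints N = (U.fixedPoints N).discs := by
  ext K H
  change U.discs.rel _ _ ↔ _
  rw [discs_rel_iff, discs_rel_iff,
    Subgroup.comap_le_comap_of_surjective (QuotientGroup.mk'_surjective N)]
  refine and_congr_right fun hKH => ⟨?_, ?_⟩
  · rintro ⟨x, hx⟩
    have hN : ∀ n : N, U.rep n x = x := fun n => by
      have h1 : QuotientGroup.mk' N n = 1 := (QuotientGroup.eq_one_iff _).2 n.2
      exact (hx n (by simp [Subgroup.mem_comap, h1])).2 (by simp [Subgroup.mem_comap, h1])
    refine ⟨⟨x, hN⟩, fun h hh => ?_⟩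
    obtain ⟨g, rfl⟩ := QuotientGroup.mk'_surjective N h
    exact Subtype.ext_iff.trans (hx g hh)
  · rintro ⟨x, hx⟩
    exact ⟨x.1, fun g hg => Subtype.ext_iff.symm.trans (hx (QuotientGroup.mk' N g) hg)⟩

lemma discs_inflate [Finite G] (N : Subgroup G) [N.Normal] (W : GUniverse.{u} 𝕂 (G ⧸ N)) :
    (W.inflate N).discs = W.discs.inflate N := by
  ext M L
  rw [discs_rel_iff]
  constructor
  · rintro ⟨hML, (x : W.carrier), hx⟩
    -- the stabilizer of `x` in the image of `L`
    let K : Subgroup (G ⧸ N) :=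
      { carrier := {g | g ∈ L.map (QuotientGroup.mk' N) ∧ W.rep g x = x}
        one_mem' := ⟨one_mem _, by simp⟩
        mul_mem' := fun {a b} ha hb => ⟨mul_mem ha.1 hb.1, by rw [rep_mul, hb.2, ha.2]⟩
        inv_mem' := fun {a} ha => ⟨inv_mem ha.1, by
          conv_lhs => rw [← ha.2]
          exact W.rep_inv_rep a x⟩ }
    refine ⟨K, L.map (QuotientGroup.mk' N), ?_, Subgroup.le_comap_map _ _, ?_⟩
    · exact (W.discs_rel_iff _ _).2 ⟨fun g hg => hg.1, x, fun g hg => ⟨fun h => ⟨hg, h⟩, And.right⟩⟩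
    · ext m
      constructor
      · exact fun hm => ⟨⟨⟨m, hML hm, rfl⟩, (hx m (hML hm)).2 hm⟩, hML hm⟩
      · exact fun hm => (hx m hm.2).1 hm.1.2
  · rintro ⟨K, H, hKH, hL, rfl⟩
    obtain ⟨_, x, hx⟩ := (W.discs_rel_iff _ _).1 hKH
    exact ⟨inf_le_right, x, fun l hl =>
      (hx _ (hL hl)).trans ⟨fun h => ⟨h, hl⟩, fun h => h.1⟩⟩

/-! ### Induction -/

/-- In a universe, the common stabilizer of finitely many vectors is the stabilizer of a single
vector. -/
lemma exists_fixed_iff_forall_fixed [Finite G] (U : GUniverse.{u} 𝕂 G) {ι : Type*} [Finite ι]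
    (y : ι → U.carrier) : ∃ x, ∀ g, U.rep g x = x ↔ ∀ i, U.rep g (y i) = y i := by
  let S : Submodule 𝕂 U.carrier := Submodule.span 𝕂 (Set.range y)
  have hS : FiniteDimensional 𝕂 S := FiniteDimensional.span_of_finite 𝕂 (Set.finite_range y)
  let V := U.orbitSpan S
  have hy : ∀ i, y i ∈ V.toSubmodule := fun i =>
    U.le_orbitSpan S (Submodule.subset_span ⟨i, rfl⟩)
  let e := Finite.equivFin ι
  obtain ⟨f, hf, hfe⟩ := U.exists_embedding V inferInstance (Nat.card ι)
  -- the family itself is a vector of a multiple of the subrepresentation it generates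
  refine ⟨f fun j => ⟨y (e.symm j), hy _⟩, fun g => ?_⟩
  rw [← hfe, hf.eq_iff, funext_iff, e.symm.forall_congr_left]
  refine forall_congr' fun i => Subtype.ext_iff.trans ?_
  simp only [Equiv.symm_symm, Equiv.symm_apply_apply]
  exact Iff.rfl

lemma discs_rel_of_discs_induce_rel [Finite G] (hG : ∀ a b : G, a * b = b * a) {H : Subgroup G}
    (U : GUniverse.{u} 𝕂 H) {L K : Subgroup G} (h : U.induce.discs.rel L K) :
    U.discs.rel (L.subgroupOf H) (K.subgroupOf H) := by
  obtain ⟨hLK, f, hf⟩ := (U.induce.discs_rel_iff L K).1 h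
  let f' : U.inducedSpace := f
  obtain ⟨x, hx⟩ := U.exists_fixed_iff_forall_fixed fun g => f'.1 g
  refine (U.discs_rel_iff _ _).2 ⟨Subgroup.comap_mono hLK, x, fun k hk => ?_⟩
  refine (hx k).trans (Iff.trans ?_ (hf k hk))
  change _ ↔ U.inducedRep k f' = f'
  rw [Subtype.ext_iff, PiLp.ext_iff]
  refine forall_congr' fun g => ?_
  rw [inducedRep_apply, hG g k, inducedSpace_apply]

lemma inducedExtend_apply_mem {H : Subgroup G} (U : GUniverse.{u} 𝕂 H) (x : U.carrier) (h : H) :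
    (U.inducedExtend x).1 h = U.rep h x := by
  simp [inducedExtend]

lemma inducedExtend_apply_notMem {H : Subgroup G} (U : GUniverse.{u} 𝕂 H) (x : U.carrier) {g : G}
    (hg : g ∉ H) : (U.inducedExtend x).1 g = 0 := by
  simp [inducedExtend, hg]

/-- A vector `x ≠ 0` with stabilizer `L ∩ H` in `K ∩ H` induces a vector with stabilizer `L` in
`K`, the sum of the translates under `L` of the extension of `x` by zero. -/
lemma exists_inducedRep_fixed_iff [Finite G] {H : Subgroup G} (U : GUniverse.{u} 𝕂 H)
    {L K : Subgroup G} (hLK : L ≤ K) {x : U.carrier} (hx0 : x ≠ 0)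
    (hx : ∀ h : H, (h : G) ∈ K → (U.rep h x = x ↔ (h : G) ∈ L)) :
    ∃ f : U.inducedSpace, ∀ k ∈ K, U.inducedRep k f = f ↔ k ∈ L := by
  classical
  have := Fintype.ofFinite L
  let f : U.inducedSpace := ∑ l : L, U.inducedRep l (U.inducedExtend x)
  have hf : ∀ g, f.1 g = ∑ l : L, (U.inducedExtend x).1 (g * l) := fun g => by
    simp [f, inducedRep_apply]
  have hfL : ∀ k ∈ L, U.inducedRep k f = f := fun k hk => by
    rw [map_sum]
    refine Fintype.sum_equiv (Equiv.mulLeft ⟨k, hk⟩) _ _ fun l => ?_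
    rw [← Module.End.mul_apply, ← map_mul]
    rfl
  -- the summands of the value at `1` that do not vanish are indexed by `L ∩ H`, which fixes `x`
  obtain ⟨n, hn, hf1⟩ : ∃ n : ℕ, n ≠ 0 ∧ f.1 1 = (n : 𝕂) • x := by
    have h1 : ∀ l : L, (U.inducedExtend x).1 (1 * l) = if (l : G) ∈ H then x else 0 := fun l => by
      rw [one_mul]
      split_ifs with hl
      · exact (U.inducedExtend_apply_mem x ⟨l, hl⟩).trans ((hx ⟨l, hl⟩ (hLK l.2)).2 l.2)
      · exact U.inducedExtend_apply_notMem x hl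
    rw [hf, Finset.sum_congr rfl fun l _ => h1 l, Finset.sum_ite, Finset.sum_const_zero, add_zero,
      Finset.sum_const, ← Nat.cast_smul_eq_nsmul 𝕂]
    exact ⟨_, (Finset.card_pos.2 ⟨1, by simp [H.one_mem]⟩).ne', rfl⟩
  have hn' : (n : 𝕂) ≠ 0 := Nat.cast_ne_zero.2 hn
  refine ⟨f, fun k hk => ⟨fun hkf => ?_, hfL k⟩⟩
  -- `f` does not vanish at `k`, so `k` lies in `HL`
  have h1 : f.1 k = f.1 1 := by
    have := U.inducedRep_apply k f 1
    rwa [hkf, one_mul, eq_comm] at this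
  obtain ⟨l, hl⟩ : ∃ l : L, k * l ∈ H := by
    by_contra! h2
    have h3 : f.1 k = 0 := by
      rw [hf]
      exact Finset.sum_eq_zero fun l _ => U.inducedExtend_apply_notMem x (h2 l)
    rw [h1, hf1] at h3
    exact smul_ne_zero hn' hx0 h3
  have h2 : U.rep ⟨k * l, hl⟩ x = x := by
    have h3 := U.inducedSpace_apply f ⟨k * l, hl⟩ 1
    have h4 := U.inducedRep_apply l f k
    rw [hfL l l.2, h1] at h4
    rw [mul_one, ← h4, hf1, map_smul] at h3
    exact (smul_right_injective _ hn' h3).symm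
  exact (L.mul_mem_cancel_right l.2).1 ((hx ⟨k * l, hl⟩ (K.mul_mem hk (hLK l.2))).1 h2)

lemma discs_induce_rel_of_discs_rel [Finite G] {H : Subgroup G} (U : GUniverse.{u} 𝕂 H)
    {L K : Subgroup G} (hLK : L ≤ K) (h : U.discs.rel (L.subgroupOf H) (K.subgroupOf H)) :
    U.induce.discs.rel L K := by
  obtain ⟨_, x, hx⟩ := (U.discs_rel_iff _ _).1 h
  refine (U.induce.discs_rel_iff L K).2 ⟨hLK, ?_⟩
  by_cases hx0 : x = 0
  · -- then `L ∩ H = K ∩ H`, and a nonzero fixed vector can take the place of `x`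
    obtain ⟨y, hy0, hy⟩ := U.exists_fixed
    refine U.exists_inducedRep_fixed_iff hLK hy0 fun h hh => ⟨fun _ => ?_, fun _ => hy h⟩
    exact (hx h hh).1 (by rw [hx0, map_zero])
  · exact U.exists_inducedRep_fixed_iff hLK hx0 hx

lemma discs_induce [Finite G] (hG : ∀ a b : G, a * b = b * a) {H : Subgroup G}
    (U : GUniverse.{u} 𝕂 H) : U.induce.discs = U.discs.coind := by
  ext L K
  rw [TransferSystem.coind_rel_of_comm hG]
  exact ⟨fun h => ⟨U.induce.discs.le_of_rel h, U.discs_rel_of_discs_induce_rel hG h⟩,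
    fun h => U.discs_induce_rel_of_discs_rel h.1 h.2⟩

end GUniverse

theorem mainTheorem2 {𝕂 : Type} [RCLike 𝕂] {G : Type v} [Group G] [Finite G] :
    -- `𝒟` and `ℒ` commute with restriction to subgroups
    (∀ (U : GUniverse.{u} 𝕂 G) (H : Subgroup G),
      (U.res H).discs = U.discs.res H ∧
      (U.res H).linearIsometries = U.linearIsometries.res H ∧
      (U.res H).linearEmbeddings = U.linearEmbeddings.res H) ∧
    -- `𝒟(U)^N = 𝒟(U^N)`
    (∀ (N : Subgroup G) [N.Normal] (U : GUniverse.{u} 𝕂 G),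
      U.discs.fixedPoints N = (U.fixedPoints N).discs) ∧
    -- `𝒟(inf W) = inf 𝒟(W)`
    (∀ (N : Subgroup G) [N.Normal] (W : GUniverse.{u} 𝕂 (G ⧸ N)),
      (W.inflate N).discs = W.discs.inflate N) ∧
    -- for abelian `G`, `𝒟(ind U) = coind 𝒟(U)`
    ((∀ a b : G, a * b = b * a) → ∀ (H : Subgroup G) (U : GUniverse.{u} 𝕂 H),
      U.induce.discs = U.discs.coind) := by
  exact ⟨fun U H => ⟨U.discs_res H, U.linearIsometries_res H, U.linearEmbeddings_res H⟩,
    fun N _ U => U.discs_fixedPoints N, fun N _ W => W.discs_inflate N,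
    fun hG _ U => U.discs_induce hG⟩
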